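/- Let $r_1\ge 0$ be an integer, and let $x>0$ and $\rho>-\tfrac12$ be real. Let $J_\nu$ denote the ordinary Bessel function of order $\nu$, and put $$K_{\rho+1/2}(x;-\tfrac12;r_1+1):=\int_0^\infty u_{r_1}^{\rho}J_{-1/2}(u_{r_1})\,du_{r_1}\int_0^\infty u_{r_1-1}^{\rho}J_{-1/2}(u_{r_1-1})\,du_{r_1-1}\cdots\int_0^\infty u_1^{\rho}J_{-1/2}(u_1)\,J_{\rho+1/2}\!\left(\frac{x}{u_1u_2\cdots u_{r_1}}\right)du_1 ,$$ an iterated integral in which each integral is an improper one, $\int_0^\infty=\lim_{a\to0+,\,b\to\infty}\int_a^b$ (for $r_1=0$ it is $J_{\rho+1/2}(x)$). For lists of complex parameters, let $$G_{p,q}^{m,n}\left(z\,\Bigg|\begin{matrix}a_1,\dots,a_p\\ b_1,\dots,b_q\end{matrix}\right):=\frac1{2\pi i}\int_L\frac{\prod_{j=1}^m\Gamma(b_j-s)\prod_{j=1}^n\Gamma(1-a_j+s)}{\prod_{j=m+1}^q\Gamma(1-b_j+s)\prod_{j=n+1}^p\Gamma(a_j-s)}\,z^s\,ds$$ be the Meijer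 $G$-function, where $L$ is a path $s=\gamma(t)+it$, $-\infty<t<\infty$, with $\gamma$ real-valued, bounded and continuously differentiable, which has the poles of $\Gamma(1-a_j+s)$, $1\le j\le n$, on its left and the poles of $\Gamma(b_j-s)$, $1\le j\le m$, on its right, and along which the integral converges absolutely. Then all the successive improper integrals in the definition of $K_{\rho+1/2}(x;-\tfrac12;r_1+1)$ converge; for the parameters and the argument below such paths $L$ exist, and the value of the integral is the same for all of them; and $$K_{\rho+1/2}(x;-\tfrac12;r_1+1)=2^{-\rho+(r_1+1)/2}\,x^{\rho-1/2}\;G^{0,\,r_1+1}_{2(r_1+1),\,0}\left(\frac{4^{r_1+1}}{x^2}\,\Bigg|\begin{matrix}\tfrac12,\dots,\tfrac12,\ \rho+1,\ 0,\dots,0\\ -\end{matrix}\right),$$ where the upper parameters are $\tfrac12$ repeated $r_1+1$ times, then $\rho+1$, then $0$ repeated $r_1$ times. -/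

import Mathlib

open Filter Topology MeasureTheory

noncomputable section

/-- The ordinary Bessel function `J_ν(x)` of real order `ν` at `x > 0`, by its power series
`∑ (-1)^k / (k! Γ(k + ν + 1)) (x / 2)^(2k + ν)`. (`Real.Gamma` vanishes at `0, -1, -2, …`, so that
the terms with `1 / Γ` at a pole are `0`, as they should be.) -/
def besselJ (ν x : ℝ) : ℝ :=
  ∑' k : ℕ, (-1 : ℝ) ^ k / ((k.factorial : ℝ) * Real.Gamma ((k : ℝ) + ν + 1)) *
    (x / 2) ^ (2 * (k : ℝ) + ν)

/-- `I` is the value of the (possibly only conditionally) convergent improper integral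
`∫_0^∞ f(u) du`: `f` is integrable on every `[a, b]` with `0 < a ≤ b`, and `∫_a^b f` tends to `I` as
`a → 0+` and `b → ∞` independently. -/
def HasImproperIntegral (f : ℝ → ℝ) (I : ℝ) : Prop :=
  (∀ a b : ℝ, 0 < a → a ≤ b → IntervalIntegrable f volume a b) ∧
    Tendsto (fun p : ℝ × ℝ => ∫ u in p.1..p.2, f u) (𝓝[>] (0 : ℝ) ×ˢ atTop) (𝓝 I)

/-- `HasBesselK ρ l r x I` says that the iterated improper integral
`K_{ρ+1/2}(x; l; r+1) = ∫_0^∞ u_r^ρ J_l(u_r) du_r ∫_0^∞ u_{r-1}^ρ J_l(u_{r-1}) du_{r-1} ⋯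
  ∫_0^∞ u_1^ρ J_l(u_1) J_{ρ+1/2}(x / (u_1 u_2 ⋯ u_r)) du_1`
converges, meaning that each of the successive improper integrals does, and that its value is `I`.
In the second clause the variable `u` is the outermost one and `F u` is the value of the
remaining `r`-fold iterated integral, whose argument is `x / u`. -/
def HasBesselK (ρ l : ℝ) : ℕ → ℝ → ℝ → Prop
  | 0, x, I => I = besselJ (ρ + 1 / 2) x
  | r + 1, x, I => ∃ F : ℝ → ℝ, (∀ u : ℝ, 0 < u → HasBesselK ρ l r (x / u) (F u)) ∧
      HasImproperIntegral (fun u => u ^ ρ * besselJ l u * F u) I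

/-- The integrand of the Meijer function `G^{m,n}_{p,q}(z | a; b)`, with `p = a.length` and
`q = b.length`:
`∏_{j ≤ m} Γ(b_j - s) ∏_{j ≤ n} Γ(1 - a_j + s) /
  (∏_{m < j ≤ q} Γ(1 - b_j + s) ∏_{n < j ≤ p} Γ(a_j - s)) * z^s`. -/
def meijerIntegrand (m n : ℕ) (a b : List ℂ) (z s : ℂ) : ℂ :=
  (((b.take m).map fun c => Complex.Gamma (c - s)).prod *
      ((a.take n).map fun c => Complex.Gamma (1 - c + s)).prod) /
    (((b.drop m).map fun c => Complex.Gamma (1 - c + s)).prod *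
      ((a.drop n).map fun c => Complex.Gamma (c - s)).prod) * z ^ s

/-- The point with parameter `t` of the upward path `s = γ(t) + i t`. -/
def meijerPath (γ : ℝ → ℝ) (t : ℝ) : ℂ := (γ t : ℂ) + (t : ℂ) * Complex.I

/-- `s = γ(t) + i t` is a continuously differentiable path from `-i∞` to `+i∞` inside a vertical
strip. It has the poles `a_j - 1 - k` of the `Γ(1 - a_j + s)`, `j ≤ n`, on its left and the poles
`b_j + k` of the `Γ(b_j - s)`, `j ≤ m`, on its right. -/
structure IsMeijerPath (m n : ℕ) (a b : List ℂ) (γ : ℝ → ℝ) : Prop where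
  contDiff : ContDiff ℝ 1 γ
  bounded : ∃ M : ℝ, ∀ t : ℝ, |γ t| ≤ M
  left : ∀ c ∈ a.take n, ∀ k : ℕ, (c - 1 - (k : ℂ)).re < γ (c - 1 - (k : ℂ)).im
  right : ∀ c ∈ b.take m, ∀ k : ℕ, γ (c + (k : ℂ)).im < (c + (k : ℂ)).re

/-- The pullback of the integrand to the parameter `t` of the path; `γ'(t) + i` is the velocity. -/
def meijerPullback (m n : ℕ) (a b : List ℂ) (z : ℂ) (γ : ℝ → ℝ) (t : ℝ) : ℂ :=
  meijerIntegrand m n a b z (meijerPath γ t) * (((deriv γ t : ℝ) : ℂ) + Complex.I)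

/-- `w` is the value of the Meijer function `G^{m,n}_{p,q}(z | a; b)`, with `p = a.length` and
`q = b.length`: there is a separating path along which the defining contour integral converges
absolutely, and along every such path `(1 / 2πi) ∫_L` of the integrand is `w`. -/
def HasMeijerG (m n : ℕ) (a b : List ℂ) (z w : ℂ) : Prop :=
  (∃ γ : ℝ → ℝ, IsMeijerPath m n a b γ ∧ Integrable (meijerPullback m n a b z γ)) ∧
    ∀ γ : ℝ → ℝ, IsMeijerPath m n a b γ → Integrable (meijerPullback m n a b z γ) →
      1 / (2 * (Real.pi : ℂ) * Complex.I) * ∫ t : ℝ, meijerPullback m n a b z γ t = w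

end

/-! Write Φ_r(s) = Γ(1/2+s)^(r+1) / (Γ(ρ+1-s) Γ(-s)^r) (`besselKernel`). By induction on r, the
iterated integral is 2^(-ρ+(r+1)/2) x^(ρ-1/2) times (1/2πi)∫ Φ_r(s) (4^(r+1)/x²)^s ds over a
vertical line slightly to the right of -1/2, where this integral converges absolutely.

For r = 0, pushing the line leftwards across the poles -1/2-n turns the integral into a sum of
residues, which is the power series of the Bessel function (`hasSum_bessel_residues`). For the
induction step, J_{-1/2}(u) = √(2/(πu)) cos u makes all powers of u outside the contour integral
cancel. What remains is the integral of cos u against the contour integral at argument z u², with z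
= 4^(r+1)/x². The conditionally convergent Mellin transform ∫ u^(2s) cos u du = √π 4^s
Γ(1/2+s)/Γ(-s) (`tendsto_integral_cpow_mul_cos`) carries Φ_r(s) z^s to √π Φ_{r+1}(s) (4z)^s.

The delicate point is the interchange of the two integrals. Over 0 < u ≤ 1 it is plain Fubini on the
line. Over u ≥ 1 the truncated cosine integrals are only O(|s|), uniformly in the truncation, and
the kernel on the line need not absorb that factor. The contour is therefore bent towards Re s = -2
at both ends, where it does; the limit is taken there, and the contour is then moved back
(`tendsto_integral_one_besselKernel`).

Independence of the path (`integral_besselKernel_path_eq`) has to cover every absolutely convergent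
path, with no bound on its slope. Numerator and denominator contain equally many Gamma factors, so
the exponential decay cancels and |Φ_r(σ+it)| is comparable, above and below, to a power of |t|
whose exponent is affine in σ. On a horizontal segment between two paths the integrand is then
controlled by its values at the endpoints, and integrability makes these small at arbitrarily large
heights. -/

/-! ### Cauchy's theorem between two graphs over the imaginary axis. -/

/-- The integral of a holomorphic function along the horizontal segment between two graphs has
the difference of the velocities of the two pullbacks as its derivative. -/
theorem hasDerivAt_horizontal_integral {f : ℂ → ℂ} {γ₀ γ₁ : ℝ → ℝ} (h₀ : ContDiff ℝ 1 γ₀)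
    (h₁ : ContDiff ℝ 1 γ₁) {U : Set ℂ} (hU : IsOpen U) (hf : DifferentiableOn ℂ f U) (t : ℝ)
    (hmem : ∀ σ ∈ Set.uIcc (γ₀ t) (γ₁ t), (σ : ℂ) + (t : ℂ) * Complex.I ∈ U) :
    HasDerivAt (fun t : ℝ => ∫ σ in γ₀ t..γ₁ t, f ((σ : ℂ) + (t : ℂ) * Complex.I))
      (f (meijerPath γ₁ t) * (((deriv γ₁ t : ℝ) : ℂ) + Complex.I) -
        f (meijerPath γ₀ t) * (((deriv γ₀ t : ℝ) : ℂ) + Complex.I)) t := by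
  set S : Set ℂ := segment ℝ (meijerPath γ₀ t) (meijerPath γ₁ t) with hS
  have hSU : S ⊆ U := by
    intro z hz
    rw [hS, segment_eq_image] at hz
    obtain ⟨θ, hθ, rfl⟩ := hz
    have := hmem ((1 - θ) * γ₀ t + θ * γ₁ t) (by
      rw [← segment_eq_uIcc, segment_eq_image]
      exact ⟨θ, hθ, by simp⟩)
    convert this using 1
    simp [meijerPath]
    ring
  have hSc : IsCompact S := by
    rw [hS, segment_eq_image]
    exact isCompact_Icc.image (by fun_prop)
  -- A thickening of a segment is convex, so `f` has a primitive `g` on it; for nearby heights the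
  -- horizontal integral is a difference of values of `g`.
  obtain ⟨δ, hδ, hδU⟩ := hSc.exists_thickening_subset_open hU hSU
  set V := Metric.thickening δ S with hV
  have hVc : Convex ℝ V := (convex_segment _ _).thickening δ
  have hVo : IsOpen V := Metric.isOpen_thickening
  obtain ⟨g, hg⟩ := hVc.exists_forall_hasDerivWithinAt (hf.mono hδU)
  have hg' : ∀ a ∈ V, HasDerivAt g (f a) a := fun a ha =>
    (hg a ha).hasDerivAt (hVo.mem_nhds ha)
  have hSV : S ⊆ V := Metric.self_subset_thickening hδ S
  have hpath : ∀ {γ : ℝ → ℝ}, ContDiff ℝ 1 γ → ∀ u, HasDerivAt (meijerPath γ)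
      (((deriv γ u : ℝ) : ℂ) + Complex.I) u := by
    intro γ hγ u
    have h1 := ((hγ.differentiable one_ne_zero) u).hasDerivAt.ofReal_comp
    have h2 := ((hasDerivAt_id u).ofReal_comp).mul_const Complex.I
    exact (h1.add h2).congr_deriv (by simp)
  have hev : ∀ᶠ u in 𝓝 t, meijerPath γ₀ u ∈ V ∧ meijerPath γ₁ u ∈ V := by
    refine ((hpath h₀ t).continuousAt.eventually_mem (hVo.mem_nhds (hSV ?_))).and
      ((hpath h₁ t).continuousAt.eventually_mem (hVo.mem_nhds (hSV ?_)))
    · exact left_mem_segment _ _ _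
    · exact right_mem_segment _ _ _
  have heq : (fun t : ℝ => ∫ σ in γ₀ t..γ₁ t, f ((σ : ℂ) + (t : ℂ) * Complex.I)) =ᶠ[𝓝 t]
      fun u => g (meijerPath γ₁ u) - g (meijerPath γ₀ u) := by
    filter_upwards [hev] with u hu
    have hseg : ∀ σ ∈ Set.uIcc (γ₀ u) (γ₁ u), (σ : ℂ) + (u : ℂ) * Complex.I ∈ V := by
      intro σ hσ
      rw [← segment_eq_uIcc, segment_eq_image] at hσ
      obtain ⟨θ, hθ, rfl⟩ := hσ
      have := hVc.segment_subset hu.1 hu.2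
      apply this
      rw [segment_eq_image]
      refine ⟨θ, hθ, ?_⟩
      simp [meijerPath]
      ring
    have hlin : ∀ σ : ℝ, HasDerivAt (fun σ : ℝ => (σ : ℂ) + (u : ℂ) * Complex.I) 1 σ := by
      intro σ
      simpa using (hasDerivAt_id σ).ofReal_comp.add_const ((u : ℂ) * Complex.I)
    rw [intervalIntegral.integral_eq_sub_of_hasDerivAt
      (f := fun σ : ℝ => g ((σ : ℂ) + (u : ℂ) * Complex.I))]
    · simp [meijerPath]
    · intro σ hσ
      exact ((hg' _ (hseg σ hσ)).comp σ (hlin σ)).congr_deriv (mul_one _)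
    · apply ContinuousOn.intervalIntegrable
      intro σ hσ
      have hd : ContinuousAt f ((σ : ℂ) + (u : ℂ) * Complex.I) :=
        ((hf.mono hδU).differentiableAt (hVo.mem_nhds (hseg σ hσ))).continuousAt
      exact (ContinuousAt.comp (f := fun σ : ℝ => (σ : ℂ) + (u : ℂ) * Complex.I)
        hd (hlin σ).continuousAt).continuousWithinAt
  refine HasDerivAt.congr_of_eventuallyEq ?_ heq
  exact ((hg' _ (hSV (right_mem_segment _ _ _))).comp t (hpath h₁ t)).sub
    ((hg' _ (hSV (left_mem_segment _ _ _))).comp t (hpath h₀ t))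

theorem continuous_meijerPath {γ : ℝ → ℝ} (h : Continuous γ) : Continuous (meijerPath γ) := by
  unfold meijerPath
  fun_prop

/-- Shifting a contour: the integrals of a holomorphic function along two graphs agree if the
function is small on horizontal segments between them at arbitrarily large heights. -/
theorem integral_path_eq_of_horizontal_small {f : ℂ → ℂ} {γ₀ γ₁ : ℝ → ℝ} (h₀ : ContDiff ℝ 1 γ₀)
    (h₁ : ContDiff ℝ 1 γ₁) {U : Set ℂ} (hU : IsOpen U) (hf : DifferentiableOn ℂ f U)
    (hmem : ∀ t : ℝ, ∀ σ ∈ Set.uIcc (γ₀ t) (γ₁ t), (σ : ℂ) + (t : ℂ) * Complex.I ∈ U)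
    (hi₀ : Integrable fun t => f (meijerPath γ₀ t) * (((deriv γ₀ t : ℝ) : ℂ) + Complex.I))
    (hi₁ : Integrable fun t => f (meijerPath γ₁ t) * (((deriv γ₁ t : ℝ) : ℂ) + Complex.I))
    {M : ℝ} (hM : ∀ t, |γ₁ t - γ₀ t| ≤ M) {h : ℝ → ℝ}
    (hh : ∀ t : ℝ, 1 ≤ |t| → ∀ σ ∈ Set.uIcc (γ₀ t) (γ₁ t),
      ‖f ((σ : ℂ) + (t : ℂ) * Complex.I)‖ ≤ h t)
    (hsmall : ∀ ε > 0, ∃ᶠ T in atTop, h T < ε ∧ h (-T) < ε) :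
    ∫ t, f (meijerPath γ₀ t) * (((deriv γ₀ t : ℝ) : ℂ) + Complex.I) =
      ∫ t, f (meijerPath γ₁ t) * (((deriv γ₁ t : ℝ) : ℂ) + Complex.I) := by
  have hM0 : 0 ≤ M := (abs_nonneg _).trans (hM 0)
  set H : ℝ → ℂ := fun t => ∫ σ in γ₀ t..γ₁ t, f ((σ : ℂ) + (t : ℂ) * Complex.I) with hH
  have hFTC : ∀ T : ℝ, ∫ t in -T..T, (f (meijerPath γ₁ t) * (((deriv γ₁ t : ℝ) : ℂ) + Complex.I) -
        f (meijerPath γ₀ t) * (((deriv γ₀ t : ℝ) : ℂ) + Complex.I)) = H T - H (-T) := by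
    intro T
    apply intervalIntegral.integral_eq_sub_of_hasDerivAt
    · intro t _
      exact hasDerivAt_horizontal_integral h₀ h₁ hU hf t (hmem t)
    · exact (hi₁.sub hi₀).intervalIntegrable
  have hbound : ∀ T : ℝ, 1 ≤ |T| → ‖H T‖ ≤ h T * M := by
    intro T hT
    have hn : 0 ≤ h T := (norm_nonneg _).trans (hh T hT _ Set.left_mem_uIcc)
    refine (intervalIntegral.norm_integral_le_of_norm_le_const (C := h T) ?_).trans ?_
    · intro σ hσ
      exact hh T hT σ (Set.uIoc_subset_uIcc hσ)
    · exact mul_le_mul_of_nonneg_left (hM T) hn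
  have hlim := (intervalIntegral_tendsto_integral (hi₁.sub hi₀) tendsto_neg_atTop_atBot
    tendsto_id).norm
  have hzero : ∀ ε > 0, ‖∫ t, ((fun t => f (meijerPath γ₁ t) * (((deriv γ₁ t : ℝ) : ℂ) + Complex.I)) -
        fun t => f (meijerPath γ₀ t) * (((deriv γ₀ t : ℝ) : ℂ) + Complex.I)) t‖ ≤ 2 * M * ε := by
    intro ε hε
    -- The truncated integrals converge because both pullbacks are integrable, so smallness along
    -- some unbounded set of heights determines the limit.
    refine le_of_tendsto_of_frequently hlim ?_
    refine ((hsmall ε hε).and_eventually (eventually_ge_atTop 1)).mono ?_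
    rintro T ⟨⟨hT1, hT2⟩, hT⟩
    have e := hFTC T
    simp only [Pi.sub_apply, id]
    rw [e]
    refine (norm_sub_le _ _).trans ?_
    have a1 := hbound T (by rwa [abs_of_nonneg (by linarith)])
    have a2 := hbound (-T) (by rwa [abs_neg, abs_of_nonneg (by linarith)])
    nlinarith
  have h0 : ‖∫ t, ((fun t => f (meijerPath γ₁ t) * (((deriv γ₁ t : ℝ) : ℂ) + Complex.I)) -
        fun t => f (meijerPath γ₀ t) * (((deriv γ₀ t : ℝ) : ℂ) + Complex.I)) t‖ ≤ 0 := by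
    refine le_of_forall_pos_le_add fun ε hε => ?_
    refine (hzero (ε / (2 * M + 1)) (by positivity)).trans ?_
    rw [zero_add, mul_div_assoc', div_le_iff₀ (by positivity)]
    nlinarith
  have h1 := norm_le_zero_iff.mp h0
  rw [integral_sub' hi₁ hi₀, sub_eq_zero] at h1
  exact h1.symm

/-! ### Growth of the Gamma function on vertical lines. -/

/-- A second-order Taylor bound for `y ↦ log |y + i t|`. -/
theorem abs_log_sq_add_sq_taylor_le {M t k p : ℝ} (hM : 0 ≤ M) (hp : |p| ≤ M) (ht : 1 ≤ |t|) :
    |1 / 2 * Real.log ((k + p) ^ 2 + t ^ 2) - 1 / 2 * Real.log (k ^ 2 + t ^ 2) -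
      p * (k / (k ^ 2 + t ^ 2))| ≤ M ^ 2 * (2 + 2 * M ^ 2) / (k ^ 2 + 1) := by
  have ht2 : 1 ≤ t ^ 2 := by rw [← sq_abs]; nlinarith
  have hpos : ∀ y : ℝ, 0 < y ^ 2 + t ^ 2 := fun y => by positivity
  have hd : ∀ y : ℝ, HasDerivAt (fun y => 1 / 2 * Real.log (y ^ 2 + t ^ 2) - y * (k / (k ^ 2 + t ^ 2)))
      (y / (y ^ 2 + t ^ 2) - k / (k ^ 2 + t ^ 2)) y := by
    intro y
    have h1 := ((((hasDerivAt_id y).pow 2).add_const (t ^ 2)).log (hpos y).ne').const_mul (1 / 2)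
    have h2 := (hasDerivAt_id y).mul_const (k / (k ^ 2 + t ^ 2))
    refine (h1.sub h2).congr_deriv ?_
    simp
    field_simp
  have hb : ∀ y ∈ Set.Icc (k - M) (k + M), ‖y / (y ^ 2 + t ^ 2) - k / (k ^ 2 + t ^ 2)‖ ≤
      M * (2 + 2 * M ^ 2) / (k ^ 2 + 1) := by
    intro y hy
    have hyk : |y - k| ≤ M := abs_le.mpr ⟨by linarith [hy.1], by linarith [hy.2]⟩
    have hyk2 : (y - k) ^ 2 ≤ M ^ 2 := by rw [← sq_abs]; gcongr
    have e : y / (y ^ 2 + t ^ 2) - k / (k ^ 2 + t ^ 2) =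
        (y - k) * (t ^ 2 - y * k) / ((y ^ 2 + t ^ 2) * (k ^ 2 + t ^ 2)) := by
      have := (hpos y).ne'
      have := (hpos k).ne'
      field_simp
      ring
    have hA : k ^ 2 + t ^ 2 ≤ (2 + 2 * M ^ 2) * (y ^ 2 + t ^ 2) := by
      nlinarith [sq_nonneg (2 * y - k), sq_nonneg (k - 2 * y), sq_nonneg M, sq_nonneg y,
        mul_nonneg (sq_nonneg M) (sq_nonneg y), mul_nonneg (sq_nonneg M) (sub_nonneg.2 ht2)]
    have hB : |t ^ 2 - y * k| ≤ (2 + 2 * M ^ 2) * (y ^ 2 + t ^ 2) := by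
      rw [abs_le]
      constructor <;> nlinarith [sq_nonneg (y - k), sq_nonneg (y + k), hpos y, hpos k,
        mul_nonneg (sq_nonneg M) (hpos y).le]
    rw [e, Real.norm_eq_abs, abs_div, abs_mul, abs_of_pos (mul_pos (hpos y) (hpos k)),
      div_le_div_iff₀ (mul_pos (hpos y) (hpos k)) (by positivity)]
    have h1 : |y - k| * |t ^ 2 - y * k| ≤ M * ((2 + 2 * M ^ 2) * (y ^ 2 + t ^ 2)) := by gcongr
    have h2 : k ^ 2 + 1 ≤ k ^ 2 + t ^ 2 := by linarith
    calc |y - k| * |t ^ 2 - y * k| * (k ^ 2 + 1)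
        ≤ M * ((2 + 2 * M ^ 2) * (y ^ 2 + t ^ 2)) * (k ^ 2 + t ^ 2) := by gcongr
      _ = _ := by ring
  have hp' := abs_le.mp hp
  have := (convex_Icc (k - M) (k + M)).norm_image_sub_le_of_norm_hasDerivWithin_le
    (fun y _ => (hd y).hasDerivWithinAt) hb (x := k) (y := k + p)
    ⟨by linarith, by linarith⟩ ⟨by linarith, by linarith⟩
  rw [Real.norm_eq_abs, Real.norm_eq_abs] at this
  calc _ = |1 / 2 * Real.log ((k + p) ^ 2 + t ^ 2) - (k + p) * (k / (k ^ 2 + t ^ 2)) -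
      (1 / 2 * Real.log (k ^ 2 + t ^ 2) - k * (k / (k ^ 2 + t ^ 2)))| := by congr 1; ring
    _ ≤ _ := this
    _ ≤ M * (2 + 2 * M ^ 2) / (k ^ 2 + 1) * M := by
      have : |k + p - k| ≤ M := by simpa using hp
      gcongr
    _ = _ := by ring

/-- With φ(y) = log |y + it|, both φ(j+p) - φ(j) and p(φ(j+1) - φ(j)) equal pφ'(j) up to
O(1/(j²+1)), uniformly in |t| ≥ 1. The second family telescopes and the errors are summable, so the
constant depends on neither `n` nor `t`. -/
theorem exists_abs_sum_log_sq_add_sq_le (M : ℝ) : ∃ C : ℝ, ∀ p t : ℝ, |p| ≤ M → 1 ≤ |t| →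
    ∀ n : ℕ, |∑ j ∈ Finset.range n, (1 / 2 * Real.log (((j : ℝ) + p) ^ 2 + t ^ 2) -
        1 / 2 * Real.log ((j : ℝ) ^ 2 + t ^ 2)) -
      p * (1 / 2 * Real.log ((n : ℝ) ^ 2 + t ^ 2) - Real.log |t|)| ≤ C := by
  rcases lt_or_ge M 0 with hM | hM
  · exact ⟨0, fun p t hp => absurd ((abs_nonneg p).trans hp) (not_le.mpr hM)⟩
  have hsum : Summable fun k : ℕ => 1 / ((k : ℝ) ^ 2 + 1) := by
    refine Summable.of_nonneg_of_le (fun _ => by positivity) (fun k => ?_)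
      ((summable_nat_add_iff (f := fun k : ℕ => 2 * (1 / (k : ℝ) ^ 2)) 1).2
        ((Real.summable_one_div_nat_pow.mpr one_lt_two).mul_left 2))
    rw [mul_one_div, div_le_div_iff₀ (by positivity) (by positivity)]
    push_cast
    nlinarith [sq_nonneg ((k : ℝ) - 1)]
  -- The two summands are the Taylor errors for the increment `p` and, multiplied by |p| ≤ M, for
  -- the increment 1.
  set D := M ^ 2 * (2 + 2 * M ^ 2) + M * (1 ^ 2 * (2 + 2 * 1 ^ 2)) with hD
  have hD0 : 0 ≤ D := by positivity
  refine ⟨D * ∑' k : ℕ, 1 / ((k : ℝ) ^ 2 + 1), fun p t hp ht n => ?_⟩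
  set φ : ℝ → ℝ := fun y => 1 / 2 * Real.log (y ^ 2 + t ^ 2) with hφ
  have hφ0 : Real.log |t| = φ ((0 : ℕ) : ℝ) := by
    simp [hφ]
  have hterm : ∀ k : ℕ, |φ (k + p) - φ k - p * (φ ((k + 1 : ℕ) : ℝ) - φ k)| ≤
      D * (1 / ((k : ℝ) ^ 2 + 1)) := by
    intro k
    have h1 := abs_log_sq_add_sq_taylor_le (k := k) hM hp ht
    have h2 := abs_log_sq_add_sq_taylor_le (k := k) (p := 1) zero_le_one (by simp) ht
    have e : φ (k + p) - φ k - p * (φ ((k + 1 : ℕ) : ℝ) - φ k) =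
      (φ (k + p) - φ k - p * (k / (k ^ 2 + t ^ 2))) -
        p * (φ ((k : ℝ) + 1) - φ k - 1 * (k / (k ^ 2 + t ^ 2))) := by push_cast; ring
    rw [e]
    refine (abs_sub _ _).trans ?_
    rw [abs_mul]
    calc _ ≤ M ^ 2 * (2 + 2 * M ^ 2) / (k ^ 2 + 1) +
        M * (1 ^ 2 * (2 + 2 * 1 ^ 2) / ((k : ℝ) ^ 2 + 1)) := by gcongr
      _ = _ := by rw [hD]; ring
  have e : ∑ j ∈ Finset.range n, (φ (j + p) - φ j) - p * (φ n - Real.log |t|) =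
      ∑ j ∈ Finset.range n, (φ (j + p) - φ j - p * (φ ((j + 1 : ℕ) : ℝ) - φ j)) := by
    conv_rhs => rw [Finset.sum_sub_distrib, ← Finset.mul_sum, Finset.sum_range_sub (fun j : ℕ => φ j)]
    rw [hφ0]
  rw [e]
  refine (Finset.abs_sum_le_sum_abs _ _).trans ((Finset.sum_le_sum fun k _ => hterm k).trans ?_)
  rw [← Finset.mul_sum]
  gcongr
  exact hsum.sum_le_tsum _ (fun _ _ => by positivity)

theorem norm_add_mul_I_eq_exp {t : ℝ} (ht : 1 ≤ |t|) (y : ℝ) :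
    ‖(y : ℂ) + t * Complex.I‖ = Real.exp (1 / 2 * Real.log (y ^ 2 + t ^ 2)) := by
  have ht2 : 0 < t ^ 2 := by rw [← sq_abs]; positivity
  rw [Complex.norm_add_mul_I, Real.sqrt_eq_rpow, Real.rpow_def_of_pos (by positivity), mul_comm]

theorem tendsto_log_div_norm_add_mul_I (t : ℝ) :
    Tendsto (fun n : ℕ => Real.log n - 1 / 2 * Real.log (((n + 1 : ℕ) : ℝ) ^ 2 + t ^ 2)) atTop (𝓝 0) := by
  have h1 : Tendsto (fun n : ℕ => 1 / 2 * Real.log ((1 + 1 / (n : ℝ)) ^ 2 + (t * (1 / (n : ℝ))) ^ 2))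
      atTop (𝓝 (1 / 2 * Real.log ((1 + 0) ^ 2 + (t * 0) ^ 2))) := by
    have h0 := tendsto_one_div_atTop_nhds_zero_nat (𝕜 := ℝ)
    refine Tendsto.const_mul _ (Tendsto.log ?_ (by norm_num))
    exact ((h0.const_add 1).pow 2).add ((h0.const_mul t).pow 2)
  have h2 := h1.neg
  norm_num at h2
  refine h2.congr' ?_
  filter_upwards [eventually_ge_atTop 1] with n hn
  have hn' : (0 : ℝ) < n := by exact_mod_cast hn
  have : (((n + 1 : ℕ) : ℝ) ^ 2 + t ^ 2) = (n : ℝ) ^ 2 * ((1 + (n : ℝ)⁻¹) ^ 2 + (t * (n : ℝ)⁻¹) ^ 2) := by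
    push_cast
    field_simp
  rw [this, Real.log_mul (by positivity) (by positivity), Real.log_pow]
  push_cast
  ring

theorem norm_GammaSeq_eq {p t : ℝ} (ht : 1 ≤ |t|) {n : ℕ} (hn : 1 ≤ n) :
    ‖Complex.GammaSeq (p + t * Complex.I) n‖ =
      Real.exp (p * Real.log n - ∑ j ∈ Finset.range (n + 1), 1 / 2 * Real.log (((j : ℝ) + p) ^ 2 + t ^ 2))
        * (n.factorial : ℝ) := by
  rw [Complex.GammaSeq, norm_div, norm_mul, Complex.norm_natCast_cpow_of_pos hn, norm_prod]
  have : ∀ j ∈ Finset.range (n + 1), ‖(p : ℂ) + t * Complex.I + (j : ℂ)‖ =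
      Real.exp (1 / 2 * Real.log (((j : ℝ) + p) ^ 2 + t ^ 2)) := by
    intro j _
    rw [← norm_add_mul_I_eq_exp ht]
    congr 1
    push_cast
    ring
  rw [Finset.prod_congr rfl this, ← Real.exp_sum, Complex.norm_natCast, Real.exp_sub,
    Real.rpow_def_of_pos (by exact_mod_cast hn)]
  have hre : ((p : ℂ) + t * Complex.I).re = p := by simp
  rw [hre, mul_comm (Real.log _) p, div_mul_eq_mul_div]

/-- `|Γ(p + i t)|` is `|t| ^ p |Γ(i t)|` up to constants, uniformly for bounded `p` and `|t| ≥ 1`. -/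
theorem exists_norm_Gamma_bounds (M : ℝ) : ∃ C : ℝ, 0 < C ∧ ∀ p t : ℝ, |p| ≤ M → 1 ≤ |t| →
    ‖Complex.Gamma (p + t * Complex.I)‖ ≤ C * (|t| ^ p * ‖Complex.Gamma (t * Complex.I)‖) ∧
      |t| ^ p * ‖Complex.Gamma (t * Complex.I)‖ ≤ C * ‖Complex.Gamma (p + t * Complex.I)‖ := by
  obtain ⟨C, hC⟩ := exists_abs_sum_log_sq_add_sq_le M
  refine ⟨Real.exp C, Real.exp_pos _, fun p t hp ht => ?_⟩
  have hlog := hC p t hp ht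
  -- The Euler product carries n^p, whereas the telescoped sum produces |n+1+it|^p; `R` is their
  -- quotient and tends to 1.
  set R : ℕ → ℝ := fun n => Real.exp (p * (Real.log n - 1 / 2 * Real.log (((n + 1 : ℕ) : ℝ) ^ 2 + t ^ 2))) with hR
  have hRlim : Tendsto R atTop (𝓝 1) := by
    have := (Real.continuous_exp.tendsto _).comp ((tendsto_log_div_norm_add_mul_I t).const_mul p)
    simpa [hR, Function.comp_def] using this
  have ht0 : 0 < |t| := by linarith
  have htp : |t| ^ p = Real.exp (p * Real.log |t|) := by
    rw [Real.rpow_def_of_pos ht0, mul_comm]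
  have hG := (Complex.GammaSeq_tendsto_Gamma (p + t * Complex.I)).norm
  have hG0 := (Complex.GammaSeq_tendsto_Gamma (t * Complex.I)).norm
  have key : ∀ n : ℕ, 1 ≤ n →
      ‖Complex.GammaSeq (p + t * Complex.I) n‖ ≤
        Real.exp C * (|t| ^ p * (R n * ‖Complex.GammaSeq (t * Complex.I) n‖)) ∧
      |t| ^ p * (R n * ‖Complex.GammaSeq (t * Complex.I) n‖) ≤
        Real.exp C * ‖Complex.GammaSeq (p + t * Complex.I) n‖ := by
    intro n hn
    have h1 := norm_GammaSeq_eq (p := p) ht hn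
    have h2 := norm_GammaSeq_eq (p := 0) ht hn
    have h3 := abs_le.mp (hlog (n + 1))
    rw [Finset.sum_sub_distrib] at h3
    simp only [Complex.ofReal_zero, zero_add, zero_mul, zero_sub, add_zero] at h2
    rw [h1, h2, htp, hR]
    simp only
    have hf : (0 : ℝ) ≤ (n.factorial : ℝ) := by positivity
    simp only [← mul_assoc, ← Real.exp_add]
    constructor
    · refine mul_le_mul_of_nonneg_right (Real.exp_le_exp.mpr ?_) hf
      linarith [h3.1]
    · refine mul_le_mul_of_nonneg_right (Real.exp_le_exp.mpr ?_) hf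
      linarith [h3.2]
  constructor
  · refine le_of_tendsto_of_tendsto hG
      (((hRlim.mul hG0).const_mul (|t| ^ p)).const_mul (Real.exp C)) ?_ |>.trans_eq (by simp)
    filter_upwards [eventually_ge_atTop 1] with n hn using (key n hn).1
  · refine le_of_eq_of_le (by simp) (le_of_tendsto_of_tendsto
      ((hRlim.mul hG0).const_mul (|t| ^ p)) (hG.const_mul (Real.exp C)) ?_)
    filter_upwards [eventually_ge_atTop 1] with n hn using (key n hn).2

/-! ### The Mellin transform of the cosine, by Gaussian subordination. -/

theorem integral_cos_mul_exp_neg_mul_sq_Ioi {v : ℝ} (hv : 0 < v) :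
    ∫ u in Set.Ioi (0 : ℝ), Real.cos u * Real.exp (-v * u ^ 2) =
      √(Real.pi / v) / 2 * Real.exp (-(1 / 4) * v⁻¹) := by
  have h1 := congrArg Complex.re (fourierIntegral_gaussian (b := (v : ℂ)) (by simpa using hv) 1)
  have hint : Integrable fun x : ℝ => Complex.exp (Complex.I * 1 * x) * Complex.exp (-(v : ℂ) * x ^ 2) := by
    have h := (integrable_exp_neg_mul_sq hv).ofReal (𝕜 := ℂ)
    refine h.bdd_mul (c := 1) (show AEStronglyMeasurable
      (fun x : ℝ => Complex.exp (Complex.I * 1 * x)) volume by fun_prop)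
      (Eventually.of_forall fun x => ?_) |>.congr ?_
    · rw [show Complex.I * 1 * (x : ℂ) = x * Complex.I by ring, Complex.norm_exp_ofReal_mul_I]
    · refine Eventually.of_forall fun x => ?_
      simp
  have h2 := integral_re hint
  simp only [RCLike.re_eq_complex_re] at h2
  rw [← h2] at h1
  have e1 : ∀ x : ℝ, (Complex.exp (Complex.I * 1 * x) * Complex.exp (-(v : ℂ) * x ^ 2)).re =
      Real.cos |x| * Real.exp (-v * |x| ^ 2) := by
    intro x
    have : Complex.exp (-(v : ℂ) * x ^ 2) = ((Real.exp (-v * x ^ 2) : ℝ) : ℂ) := by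
      push_cast; rfl
    rw [this, Complex.re_mul_ofReal, show Complex.I * 1 * (x : ℂ) = x * Complex.I by ring,
      Complex.exp_ofReal_mul_I_re, Real.cos_abs, sq_abs]
  simp only [e1] at h1
  rw [integral_comp_abs (f := fun x => Real.cos x * Real.exp (-v * x ^ 2))] at h1
  have e2 : ((Real.pi : ℂ) / v) ^ (1 / 2 : ℂ) * Complex.exp (-1 ^ 2 / (4 * v)) =
      ((√(Real.pi / v) * Real.exp (-(1 / 4) * v⁻¹) : ℝ) : ℂ) := by
    rw [Real.sqrt_eq_rpow, Complex.ofReal_mul, Complex.ofReal_cpow (by positivity)]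
    push_cast
    congr 2
    field_simp
  rw [e2, Complex.ofReal_re] at h1
  linarith

/-- The bound 1 comes from integration by parts against the decreasing Gaussian and serves for small
`v`; the other drops the cosine and serves for large `v`. Together they give a majorant independent
of `b`. -/
theorem abs_integral_cos_mul_exp_neg_mul_sq_le {v b : ℝ} (hv : 0 < v) (hb : 0 ≤ b) :
    |∫ u in (0 : ℝ)..b, Real.cos u * Real.exp (-v * u ^ 2)| ≤ min 1 (√(Real.pi / v) / 2) := by
  refine le_min ?_ ?_
  · have hd : ∀ u : ℝ, HasDerivAt (fun u => Real.exp (-v * u ^ 2)) (-(2 * v * u * Real.exp (-v * u ^ 2))) u := by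
      intro u
      have := (((hasDerivAt_id u).pow 2).const_mul (-v)).exp
      refine this.congr_deriv ?_
      simp
      ring
    have hparts := intervalIntegral.integral_mul_deriv_eq_deriv_mul (a := 0) (b := b)
      (fun x _ => hd x) (fun x _ => Real.hasDerivAt_sin x)
      (Continuous.intervalIntegrable (by fun_prop) _ _)
      (Continuous.intervalIntegrable (by fun_prop) _ _)
    have hg := intervalIntegral.integral_eq_sub_of_hasDerivAt (a := 0) (b := b)
      (fun x _ => hd x) (Continuous.intervalIntegrable (by fun_prop) _ _)
    have hbd : |∫ u in (0 : ℝ)..b, -(2 * v * u * Real.exp (-v * u ^ 2)) * Real.sin u| ≤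
        ∫ u in (0 : ℝ)..b, -(-(2 * v * u * Real.exp (-v * u ^ 2))) := by
      rw [← Real.norm_eq_abs]
      refine intervalIntegral.norm_integral_le_of_norm_le hb ?_ (Continuous.intervalIntegrable (by fun_prop) _ _)
      refine Eventually.of_forall fun u hu => ?_
      have hu0 : 0 ≤ u := hu.1.le
      rw [norm_mul, norm_neg, neg_neg, Real.norm_eq_abs, Real.norm_eq_abs, abs_of_nonneg (by positivity)]
      exact mul_le_of_le_one_right (by positivity) (Real.abs_sin_le_one u)
    rw [intervalIntegral.integral_neg, hg] at hbd
    simp only [mul_comm (Real.cos _)]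
    rw [hparts]
    have h3 : |Real.exp (-v * b ^ 2) * Real.sin b| ≤ Real.exp (-v * b ^ 2) := by
      rw [abs_mul, abs_of_pos (Real.exp_pos _)]
      exact mul_le_of_le_one_right (Real.exp_pos _).le (Real.abs_sin_le_one b)
    simp only [Real.sin_zero, mul_zero, sub_zero]
    refine (abs_sub _ _).trans ?_
    simp at hbd h3 ⊢
    linarith
  · rw [← integral_gaussian_Ioi, ← Real.norm_eq_abs]
    have hI := (integrable_exp_neg_mul_sq hv)
    have h1 : ‖∫ u in (0 : ℝ)..b, Real.cos u * Real.exp (-v * u ^ 2)‖ ≤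
        ∫ u in (0 : ℝ)..b, Real.exp (-v * u ^ 2) := by
      refine intervalIntegral.norm_integral_le_of_norm_le hb ?_ hI.intervalIntegrable
      refine Eventually.of_forall fun u _ => ?_
      rw [norm_mul, Real.norm_eq_abs, Real.norm_eq_abs, abs_of_pos (Real.exp_pos _)]
      exact mul_le_of_le_one_left (Real.exp_pos _).le (Real.abs_cos_le_one u)
    refine h1.trans ?_
    rw [intervalIntegral.integral_of_le hb]
    exact setIntegral_mono_set hI.integrableOn (Eventually.of_forall fun _ => (Real.exp_pos _).le)
      (Eventually.of_forall fun x hx => hx.1)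

theorem integrableOn_rpow_mul_min_sqrt {σ : ℝ} (h1 : -(1 / 2) < σ) (h2 : σ < 0) :
    IntegrableOn (fun v : ℝ => v ^ (-σ - 1) * min 1 (√(Real.pi / v) / 2)) (Set.Ioi 0) := by
  have hmeas : Measurable fun v : ℝ => v ^ (-σ - 1) * min 1 (√(Real.pi / v) / 2) := by
    fun_prop
  rw [← Set.Ioc_union_Ioi_eq_Ioi zero_le_one]
  refine IntegrableOn.union ?_ ?_
  · have := (intervalIntegrable_iff_integrableOn_Ioc_of_le zero_le_one).1
      (intervalIntegral.intervalIntegrable_rpow' (a := 0) (b := 1) (r := -σ - 1) (by linarith))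
    refine this.mono' hmeas.aestronglyMeasurable ?_
    refine (ae_restrict_iff' measurableSet_Ioc).2 (Eventually.of_forall fun v hv => ?_)
    have hv0 := hv.1
    rw [Real.norm_eq_abs, abs_of_nonneg (by positivity)]
    exact mul_le_of_le_one_right (by positivity) (min_le_left _ _)
  · have := (integrableOn_Ioi_rpow_of_lt (a := -σ - 3 / 2) (by linarith) one_pos).const_mul (√Real.pi / 2)
    refine this.mono' hmeas.aestronglyMeasurable ?_
    refine (ae_restrict_iff' measurableSet_Ioi).2 (Eventually.of_forall fun v hv => ?_)
    have hv0 : 0 < v := zero_lt_one.trans hv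
    rw [Real.norm_eq_abs, abs_of_nonneg (by positivity)]
    refine (mul_le_mul_of_nonneg_left (min_le_right _ _) (by positivity)).trans_eq ?_
    rw [Real.sqrt_div Real.pi_pos.le, show -σ - 3 / 2 = -σ - 1 - 1 / 2 by ring, Real.rpow_sub hv0 (-σ - 1),
      ← Real.sqrt_eq_rpow]
    ring

/-- The substitution v ↦ 1/v turns this into Euler's integral for Γ(s + 1/2). -/
theorem integral_cpow_mul_exp_neg_inv_Ioi {s : ℂ} (h1 : -(1 / 2) < s.re) :
    ∫ v in Set.Ioi (0 : ℝ), (v : ℂ) ^ (-s - 1) *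
        ((√(Real.pi / v) / 2 * Real.exp (-(1 / 4) * v⁻¹) : ℝ) : ℂ) =
      (√Real.pi : ℂ) * (4 : ℂ) ^ s * Complex.Gamma (1 / 2 + s) := by
  have hm := mellin_comp_inv (fun t : ℝ => ((Real.exp (-(1 / 4) * t) : ℝ) : ℂ)) (-(s + 1 / 2))
  have hg := Complex.integral_cpow_mul_exp_neg_mul_Ioi (a := s + 1 / 2) (r := 1 / 4)
    (by simp; linarith) (by norm_num)
  rw [neg_neg] at hm
  simp only [mellin, smul_eq_mul] at hm
  have e1 : ∫ v in Set.Ioi (0 : ℝ), (v : ℂ) ^ (-s - 1) *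
        ((√(Real.pi / v) / 2 * Real.exp (-(1 / 4) * v⁻¹) : ℝ) : ℂ) =
      (√Real.pi : ℂ) / 2 * ∫ v in Set.Ioi (0 : ℝ), (v : ℂ) ^ (-(s + 1 / 2) - 1) *
        ((Real.exp (-(1 / 4) * v⁻¹) : ℝ) : ℂ) := by
    rw [← integral_const_mul]
    refine setIntegral_congr_fun measurableSet_Ioi fun v hv => ?_
    have hv0 : (0 : ℝ) < v := hv
    have hvc : (v : ℂ) ≠ 0 := by exact_mod_cast hv0.ne'
    rw [Real.sqrt_div Real.pi_pos.le, show -(s + 1 / 2) - 1 = (-s - 1) - (1 / 2 : ℂ) by ring,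
      Complex.cpow_sub (-s - 1) (1 / 2) hvc]
    have : ((√v : ℝ) : ℂ) = (v : ℂ) ^ (1 / 2 : ℂ) := by
      rw [Real.sqrt_eq_rpow, Complex.ofReal_cpow hv0.le]
      push_cast
      rfl
    push_cast
    rw [this]
    ring
  have e2 : ∫ v in Set.Ioi (0 : ℝ), (v : ℂ) ^ (s + 1 / 2 - 1) * ((Real.exp (-(1 / 4) * v) : ℝ) : ℂ) =
      ∫ v in Set.Ioi (0 : ℝ), (v : ℂ) ^ (s + 1 / 2 - 1) * Complex.exp (-(((1 / 4 : ℝ) : ℂ) * v)) := by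
    congr 1 with v
    push_cast
    ring_nf
  rw [e1, hm, e2, hg]
  have h4 : (1 / (((1 / 4 : ℝ) : ℂ))) = 4 := by norm_num
  have h42 : (4 : ℂ) ^ (1 / 2 : ℂ) = 2 := by
    have h := Complex.ofReal_cpow (x := 4) (by norm_num) (1 / 2)
    rw [← Real.sqrt_eq_rpow, show (4 : ℝ) = 2 ^ 2 by norm_num, Real.sqrt_sq zero_le_two] at h
    push_cast at h
    rw [show (4 : ℂ) = 2 ^ 2 by norm_num]
    exact h.symm
  rw [h4, Complex.cpow_add _ _ (by norm_num), h42, add_comm s]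
  ring

/-- Γ(-s) u^(2s) = ∫ v^(-s-1) exp(-v u²) dv replaces the power by Gaussians, and on a bounded
`u`-interval Fubini applies. The limit b → ∞ can then be taken under an absolutely convergent
`v`-integral. -/
theorem gamma_mul_integral_cpow_mul_cos {s : ℂ} (h1 : -(1 / 2) < s.re) (h2 : s.re < 0) {b : ℝ} (hb : 0 ≤ b) :
    Complex.Gamma (-s) * ∫ u in (0 : ℝ)..b, (u : ℂ) ^ (2 * s) * ((Real.cos u : ℝ) : ℂ) =
      ∫ v in Set.Ioi (0 : ℝ), (v : ℂ) ^ (-s - 1) *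
        ((∫ u in (0 : ℝ)..b, Real.cos u * Real.exp (-v * u ^ 2) : ℝ) : ℂ) := by
  set f : ℝ → ℝ → ℂ := fun u v => (v : ℂ) ^ (-s - 1) * ((Real.cos u * Real.exp (-v * u ^ 2) : ℝ) : ℂ) with hf
  have hmeas : Measurable (Function.uncurry f) := by
    simp only [hf, Function.uncurry_def]
    fun_prop
  have hnorm : ∀ u v : ℝ, 0 < v → ‖f u v‖ = |Real.cos u| * (v ^ (-s.re - 1) * Real.exp (-(u ^ 2 * v))) := by
    intro u v hv
    simp only [hf]
    rw [norm_mul, Complex.norm_cpow_eq_rpow_re_of_pos hv, Complex.norm_real, norm_mul, Real.norm_eq_abs,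
      Real.norm_eq_abs (Real.exp _), abs_of_pos (Real.exp_pos _)]
    simp
    ring_nf
  have hintv : ∀ u : ℝ, 0 < u → IntegrableOn (fun v : ℝ => v ^ (-s.re - 1) * Real.exp (-(u ^ 2 * v))) (Set.Ioi 0) := by
    intro u hu
    have := integrableOn_rpow_mul_exp_neg_mul_rpow (p := 1) (s := -s.re - 1) (b := u ^ 2)
      (by linarith) one_pos (by positivity)
    simpa using this
  have hprod : Integrable (Function.uncurry f)
      ((volume.restrict (Set.Ioc 0 b)).prod (volume.restrict (Set.Ioi 0))) := by
    rw [integrable_prod_iff hmeas.aestronglyMeasurable]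
    constructor
    · refine (ae_restrict_iff' measurableSet_Ioc).2 (Eventually.of_forall fun u hu => ?_)
      have h3 : Measurable fun v => f u v := by
        simp only [hf]
        fun_prop
      refine ((hintv u hu.1).const_mul |Real.cos u|).mono' h3.aestronglyMeasurable ?_
      exact (ae_restrict_iff' measurableSet_Ioi).2 (Eventually.of_forall fun v hv => (hnorm u v hv).le)
    · have h4 := (intervalIntegrable_iff_integrableOn_Ioc_of_le hb).1
        (intervalIntegral.intervalIntegrable_rpow' (a := 0) (b := b) (r := 2 * s.re) (by linarith))
      have h5 : IntegrableOn (fun u : ℝ => |Real.cos u| * (u ^ (2 * s.re) * Real.Gamma (-s.re))) (Set.Ioc 0 b) := by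
        refine (h4.mul_const (Real.Gamma (-s.re))).bdd_mul (c := 1) (by fun_prop) ?_
        exact Eventually.of_forall fun x => by simpa using Real.abs_cos_le_one x
      refine h5.congr ((ae_restrict_iff' measurableSet_Ioc).2 (Eventually.of_forall fun u hu => ?_))
      have hu0 := hu.1
      simp only [Function.uncurry]
      rw [setIntegral_congr_fun measurableSet_Ioi fun v hv => hnorm u v hv, integral_const_mul,
        Real.integral_rpow_mul_exp_neg_mul_Ioi (by linarith) (by positivity)]
      congr 2
      rw [one_div, Real.inv_rpow (by positivity), ← Real.rpow_neg (by positivity), neg_neg,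
        ← Real.rpow_natCast, ← Real.rpow_mul hu0.le]
      norm_num
  have hswap := integral_integral_swap hprod
  have hL : ∫ u in Set.Ioc 0 b, ∫ v in Set.Ioi (0 : ℝ), f u v =
      Complex.Gamma (-s) * ∫ u in (0 : ℝ)..b, (u : ℂ) ^ (2 * s) * ((Real.cos u : ℝ) : ℂ) := by
    rw [intervalIntegral.integral_of_le hb, ← integral_const_mul]
    refine setIntegral_congr_fun measurableSet_Ioc fun u hu => ?_
    have hu0 := hu.1
    have h6 := Complex.integral_cpow_mul_exp_neg_mul_Ioi (a := -s) (r := u ^ 2) (by simpa using h2) (by positivity)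
    have h7 : ∀ v, f u v = ((Real.cos u : ℝ) : ℂ) * ((v : ℂ) ^ (-s - 1) * Complex.exp (-(((u ^ 2 : ℝ) : ℂ) * v))) := by
      intro v
      simp only [hf]
      push_cast
      ring_nf
    simp only [h7]
    rw [integral_const_mul, h6]
    have h8 : (1 / ((u ^ 2 : ℝ) : ℂ)) ^ (-s) = (u : ℂ) ^ (2 * s) := by
      have : (1 / ((u ^ 2 : ℝ) : ℂ)) = (((u ^ 2)⁻¹ : ℝ) : ℂ) := by push_cast; simp
      rw [this, Complex.cpow_def_of_ne_zero (by exact_mod_cast (by positivity)),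
        Complex.cpow_def_of_ne_zero (by exact_mod_cast hu0.ne'), ← Complex.ofReal_log (by positivity),
        ← Complex.ofReal_log hu0.le, Real.log_inv, Real.log_pow]
      push_cast
      ring_nf
    rw [h8]
    ring
  have hR : ∫ v in Set.Ioi (0 : ℝ), ∫ u in Set.Ioc 0 b, f u v = ∫ v in Set.Ioi (0 : ℝ), (v : ℂ) ^ (-s - 1) *
        ((∫ u in (0 : ℝ)..b, Real.cos u * Real.exp (-v * u ^ 2) : ℝ) : ℂ) := by
    refine setIntegral_congr_fun measurableSet_Ioi fun v hv => ?_
    simp only [hf]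
    rw [integral_const_mul, intervalIntegral.integral_of_le hb]
    congr 1
    exact integral_ofReal
  rw [← hL, hswap, hR]

/-- The Mellin transform of the cosine, as an improper integral. -/
theorem tendsto_integral_cpow_mul_cos {s : ℂ} (h1 : -(1 / 2) < s.re) (h2 : s.re < 0) :
    Tendsto (fun b : ℝ => ∫ u in (0 : ℝ)..b, (u : ℂ) ^ (2 * s) * ((Real.cos u : ℝ) : ℂ)) atTop
      (𝓝 ((√Real.pi : ℂ) * (4 : ℂ) ^ s * Complex.Gamma (1 / 2 + s) / Complex.Gamma (-s))) := by
  have hΓ : Complex.Gamma (-s) ≠ 0 := Complex.Gamma_ne_zero_of_re_pos (by simpa using h2)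
  have key : Tendsto (fun b : ℝ => ∫ v in Set.Ioi (0 : ℝ), (v : ℂ) ^ (-s - 1) *
        ((∫ u in (0 : ℝ)..b, Real.cos u * Real.exp (-v * u ^ 2) : ℝ) : ℂ)) atTop
      (𝓝 ((√Real.pi : ℂ) * (4 : ℂ) ^ s * Complex.Gamma (1 / 2 + s))) := by
    rw [← integral_cpow_mul_exp_neg_inv_Ioi h1]
    refine tendsto_integral_filter_of_dominated_convergence
      (fun v : ℝ => v ^ (-s.re - 1) * min 1 (√(Real.pi / v) / 2)) ?_ ?_
      (integrableOn_rpow_mul_min_sqrt h1 h2) ?_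
    · refine Eventually.of_forall fun b => ?_
      refine AEStronglyMeasurable.mul (show Measurable fun v : ℝ => (v : ℂ) ^ (-s - 1) by fun_prop).aestronglyMeasurable ?_
      have : Continuous fun v : ℝ => ∫ u in (0 : ℝ)..b, Real.cos u * Real.exp (-v * u ^ 2) :=
        intervalIntegral.continuous_parametric_intervalIntegral_of_continuous' (by fun_prop) _ _
      exact (Complex.continuous_ofReal.comp this).aestronglyMeasurable
    · filter_upwards [eventually_ge_atTop 0] with b hb
      refine (ae_restrict_iff' measurableSet_Ioi).2 (Eventually.of_forall fun v hv => ?_)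
      rw [norm_mul, Complex.norm_cpow_eq_rpow_re_of_pos hv, Complex.norm_real, Real.norm_eq_abs]
      have hv0 : (0 : ℝ) < v := hv
      refine mul_le_mul (by simp) (abs_integral_cos_mul_exp_neg_mul_sq_le hv hb) (abs_nonneg _) (by positivity)
    · refine (ae_restrict_iff' measurableSet_Ioi).2 (Eventually.of_forall fun v hv => ?_)
      refine Tendsto.const_mul _ ((Complex.continuous_ofReal.tendsto _).comp ?_)
      rw [← integral_cos_mul_exp_neg_mul_sq_Ioi hv]
      refine intervalIntegral_tendsto_integral_Ioi 0 ?_ tendsto_id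
      refine ((integrable_exp_neg_mul_sq hv).bdd_mul (c := 1) (by fun_prop) ?_).integrableOn
      exact Eventually.of_forall fun x => by simpa using Real.abs_cos_le_one x
  refine (key.div_const (Complex.Gamma (-s))).congr' ?_
  filter_upwards [eventually_ge_atTop 0] with b hb
  rw [← gamma_mul_integral_cpow_mul_cos h1 h2 hb, mul_div_cancel_left₀ _ hΓ]

/-! ### The Mellin–Barnes kernel and independence of the path. -/

/-- The Mellin–Barnes kernel
`Γ(1/2 + s)^(r+1) / (Γ(ρ + 1 - s) Γ(-s)^r)`. -/
noncomputable def besselKernel (ρ : ℝ) (r : ℕ) (s : ℂ) : ℂ :=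
  Complex.Gamma (1 / 2 + s) ^ (r + 1) *
    ((Complex.Gamma ((ρ : ℂ) + 1 - s))⁻¹ * (Complex.Gamma (-s))⁻¹ ^ r)

/-- The growth exponent of `besselKernel ρ r` on the line `re s = σ`. -/
noncomputable def besselExponent (ρ : ℝ) (r : ℕ) (σ : ℝ) : ℝ :=
  2 * (r + 1) * σ + ((r + 1) / 2 - ρ - 1)

theorem meijerIntegrand_eq_besselKernel (ρ : ℝ) (r : ℕ) (z s : ℂ) :
    meijerIntegrand 0 (r + 1)
      (List.replicate (r + 1) (1 / 2 : ℂ) ++ [(ρ : ℂ) + 1] ++ List.replicate r (0 : ℂ)) [] z s =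
      besselKernel ρ r s * z ^ s := by
  have h1 : (List.replicate (r + 1) (1 / 2 : ℂ) ++ [(ρ : ℂ) + 1] ++ List.replicate r (0 : ℂ)).take (r + 1) =
      List.replicate (r + 1) (1 / 2 : ℂ) := by
    rw [List.append_assoc, List.take_left' (by simp)]
  have h2 : (List.replicate (r + 1) (1 / 2 : ℂ) ++ [(ρ : ℂ) + 1] ++ List.replicate r (0 : ℂ)).drop (r + 1) =
      [(ρ : ℂ) + 1] ++ List.replicate r (0 : ℂ) := by
    rw [List.append_assoc, List.drop_left' (by simp)]
  rw [meijerIntegrand, h1, h2, besselKernel]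
  simp only [List.map_replicate, List.prod_replicate, List.map_append, List.prod_append, List.take_nil,
    List.drop_nil, List.map_nil, List.prod_nil, List.map_cons, List.prod_singleton, one_mul, zero_sub]
  rw [show (1 : ℂ) - 1 / 2 + s = 1 / 2 + s by ring, div_eq_mul_inv, mul_inv, inv_pow]

/-- The plane slit along the poles of `Γ(1/2 + s)`. -/
def gammaSlit : Set ℂ := {s | 1 / 2 + s ∈ Complex.slitPlane}

theorem isOpen_gammaSlit : IsOpen gammaSlit :=
  Complex.isOpen_slitPlane.preimage (by fun_prop)

theorem mem_gammaSlit_of_re {s : ℂ} (h : -(1 / 2) < s.re) : s ∈ gammaSlit :=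
  Or.inl (by simp; linarith)

theorem mem_gammaSlit_of_im {s : ℂ} (h : s.im ≠ 0) : s ∈ gammaSlit :=
  Or.inr (by simpa using h)

theorem differentiableOn_besselKernel (ρ : ℝ) (r : ℕ) :
    DifferentiableOn ℂ (besselKernel ρ r) gammaSlit := by
  intro s hs
  apply DifferentiableAt.differentiableWithinAt
  have h1 : DifferentiableAt ℂ Complex.Gamma (1 / 2 + s) := by
    refine Complex.differentiableAt_Gamma _ fun m hm => ?_
    change 1 / 2 + s ∈ Complex.slitPlane at hs
    rw [hm, Complex.mem_slitPlane_iff] at hs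
    simp at hs
    linarith [hs, (Nat.cast_nonneg m : (0 : ℝ) ≤ m)]
  have h1' : DifferentiableAt ℂ (fun s : ℂ => Complex.Gamma (1 / 2 + s)) s :=
    h1.comp s (by fun_prop)
  have h2 : DifferentiableAt ℂ (fun s : ℂ => (Complex.Gamma ((ρ : ℂ) + 1 - s))⁻¹) s :=
    (Complex.differentiable_one_div_Gamma _).comp s (by fun_prop)
  have h3 : DifferentiableAt ℂ (fun s : ℂ => (Complex.Gamma (-s))⁻¹) s :=
    (Complex.differentiable_one_div_Gamma _).comp s (by fun_prop)
  exact (h1'.pow _).mul (h2.mul (h3.pow _))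

theorem norm_Gamma_sub_mul_I (p t : ℝ) :
    ‖Complex.Gamma (p - t * Complex.I)‖ = ‖Complex.Gamma (p + t * Complex.I)‖ := by
  rw [← Complex.norm_conj, ← Complex.Gamma_conj]
  simp

/-- There are r+1 Gamma factors above and r+1 below, so |Γ(it)| cancels and only a power of |t|
survives. The lower bound matters as well: it lets a path's own integrand dominate that power. -/
theorem exists_norm_besselKernel_bounds (ρ : ℝ) (r : ℕ) (M : ℝ) : ∃ C : ℝ, 0 < C ∧
    ∀ σ t : ℝ, |σ| ≤ M → 1 ≤ |t| →
      ‖besselKernel ρ r (σ + t * Complex.I)‖ ≤ C * |t| ^ besselExponent ρ r σ ∧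
        |t| ^ besselExponent ρ r σ ≤ C * ‖besselKernel ρ r (σ + t * Complex.I)‖ := by
  obtain ⟨C, hC0, hC⟩ := exists_norm_Gamma_bounds (M + |ρ| + 1)
  refine ⟨C ^ (r + 1) * (C * C ^ r), by positivity, fun σ t hσ ht => ?_⟩
  have hT : 0 < |t| := by linarith
  have hσ' := abs_le.mp hσ
  have hρ := abs_le.mp (le_refl |ρ|)
  have hg : 0 < ‖Complex.Gamma (t * Complex.I)‖ := by
    rw [norm_pos_iff]
    refine Complex.Gamma_ne_zero fun m hm => ?_
    have := congrArg Complex.im hm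
    simp at this
    simp [this] at hT
  set g := ‖Complex.Gamma (t * Complex.I)‖
  have ea : ‖Complex.Gamma (1 / 2 + ((σ : ℂ) + t * Complex.I))‖ =
      ‖Complex.Gamma (((1 / 2 + σ : ℝ) : ℂ) + t * Complex.I)‖ := by
    congr 2; push_cast; ring
  have eb : ‖Complex.Gamma ((ρ : ℂ) + 1 - ((σ : ℂ) + t * Complex.I))‖ =
      ‖Complex.Gamma (((ρ + 1 - σ : ℝ) : ℂ) + t * Complex.I)‖ := by
    rw [← norm_Gamma_sub_mul_I]; congr 2; push_cast; ring
  have ec : ‖Complex.Gamma (-((σ : ℂ) + t * Complex.I))‖ =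
      ‖Complex.Gamma (((-σ : ℝ) : ℂ) + t * Complex.I)‖ := by
    rw [← norm_Gamma_sub_mul_I]; congr 2; push_cast; ring
  have ha := hC (1 / 2 + σ) t (abs_le.mpr ⟨by linarith [abs_nonneg ρ], by linarith [abs_nonneg ρ]⟩) ht
  have hb := hC (ρ + 1 - σ) t (abs_le.mpr ⟨by linarith, by linarith⟩) ht
  have hc := hC (-σ) t (abs_le.mpr ⟨by linarith [abs_nonneg ρ], by linarith [abs_nonneg ρ]⟩) ht
  rw [besselKernel, norm_mul, norm_mul, norm_pow, norm_pow, norm_inv, norm_inv, ea, eb, ec]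
  set a := ‖Complex.Gamma (((1 / 2 + σ : ℝ) : ℂ) + t * Complex.I)‖
  set b := ‖Complex.Gamma (((ρ + 1 - σ : ℝ) : ℂ) + t * Complex.I)‖
  set c := ‖Complex.Gamma (((-σ : ℝ) : ℂ) + t * Complex.I)‖
  set A := |t| ^ (1 / 2 + σ) with hA
  set B := |t| ^ (ρ + 1 - σ) with hB
  set D := |t| ^ (-σ) with hD
  have hA0 : 0 < A := by positivity
  have hB0 : 0 < B := by positivity
  have hD0 : 0 < D := by positivity
  have hb0 : 0 < b := pos_of_mul_pos_right ((mul_pos hB0 hg).trans_le hb.2) hC0.le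
  have hc0 : 0 < c := pos_of_mul_pos_right ((mul_pos hD0 hg).trans_le hc.2) hC0.le
  have ha0 : 0 ≤ a := norm_nonneg _
  have hE : |t| ^ besselExponent ρ r σ = (A * g) ^ (r + 1) * ((B * g)⁻¹ * (D * g)⁻¹ ^ r) := by
    have : besselExponent ρ r σ = (1 / 2 + σ) * ((r + 1 : ℕ) : ℝ) - (ρ + 1 - σ) - (-σ) * (r : ℝ) := by
      rw [besselExponent]; push_cast; ring
    rw [this, Real.rpow_sub hT, Real.rpow_sub hT, Real.rpow_mul hT.le, Real.rpow_mul hT.le,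
      Real.rpow_natCast, Real.rpow_natCast, ← hA, ← hB, ← hD, mul_pow, mul_inv,
      mul_inv, mul_pow, inv_pow, inv_pow, pow_succ g]
    field_simp
  have e : ∀ x y z : ℝ, C ^ (r + 1) * (C * C ^ r) * (x ^ (r + 1) * (y * z ^ r)) =
      (C * x) ^ (r + 1) * ((C * y) * (C * z) ^ r) := by
    intro x y z
    rw [mul_pow, mul_pow]
    ring
  rw [hE, e, e]
  have inv1 : ∀ {x y : ℝ}, 0 < x → 0 < y → x ≤ C * y → y⁻¹ ≤ C * x⁻¹ := by
    intro x y hx hy h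
    rw [← div_eq_mul_inv, inv_eq_one_div, div_le_div_iff₀ hy hx]
    linarith
  constructor
  · have h1 := inv1 (by positivity) hb0 hb.2
    have h2 := inv1 (by positivity) hc0 hc.2
    have h3 := ha.1
    gcongr
  · have h1 := inv1 hb0 (by positivity) hb.1
    have h2 := inv1 hc0 (by positivity) hc.1
    have h3 := ha.2
    gcongr

/-- The power is monotone in its exponent, in one direction or the other. Hence a bound on a
horizontal segment follows from the two endpoints, whatever the size of the base. -/
theorem rpow_le_add_of_mem_uIcc {X : ℝ} (hX : 0 < X) {a b σ : ℝ} (h : σ ∈ Set.uIcc a b) :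
    X ^ σ ≤ X ^ a + X ^ b := by
  have ha : 0 ≤ X ^ a := by positivity
  have hb : 0 ≤ X ^ b := by positivity
  have hm : X ^ σ ≤ max (X ^ a) (X ^ b) := by
    rcases le_total 1 X with h1 | h1
    · have := Real.rpow_le_rpow_of_exponent_le h1 h.2
      refine this.trans ?_
      rcases le_total a b with hab | hab <;> simp [hab]
    · have := Real.rpow_le_rpow_of_exponent_ge hX h1 h.1
      refine this.trans ?_
      rcases le_total a b with hab | hab <;> simp [hab]
  exact hm.trans (max_le (by linarith) (by linarith))

theorem integrable_of_norm_le_rpow {E : Type*} [NormedAddCommGroup E] {g : ℝ → E} (hc : Continuous g)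
    {C α T : ℝ} (hα : α < -1) (hb : ∀ t : ℝ, T ≤ |t| → ‖g t‖ ≤ C * |t| ^ α) : Integrable g := by
  set S := max T 1 with hS
  have hS1 : 1 ≤ S := le_max_right _ _
  have hST : T ≤ S := le_max_left _ _
  have htail : ∀ g : ℝ → E, Continuous g → (∀ t : ℝ, T ≤ |t| → ‖g t‖ ≤ C * |t| ^ α) →
      IntegrableOn g (Set.Ioi S) := by
    intro g hc hb
    have := (integrableOn_Ioi_rpow_of_lt hα (by linarith : 0 < S)).const_mul C
    refine this.mono' hc.aestronglyMeasurable ?_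
    refine (ae_restrict_iff' measurableSet_Ioi).2 (Eventually.of_forall fun t ht => ?_)
    have ht' : S < t := ht
    have := hb t (by rw [abs_of_pos (by linarith)]; linarith)
    rwa [abs_of_pos (by linarith : 0 < t)] at this
  have h1 := htail g hc hb
  have h2 := htail (fun t => g (-t)) (by fun_prop) (fun t ht => by simpa using hb (-t) (by simpa using ht))
  have h3 : IntegrableOn g (Set.Iio (-S)) := by
    have := (Measure.measurePreserving_neg (volume : Measure ℝ)).integrableOn_comp_preimage
      (MeasurableEquiv.neg ℝ).measurableEmbedding (f := g) (s := Set.Iio (-S))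
    have e : Neg.neg ⁻¹' Set.Iio (-S) = Set.Ioi S := by
      ext x
      simp
    refine this.1 ?_
    rw [e]
    exact h2
  have h4 : IntegrableOn g (Set.Icc (-S) S) := hc.integrableOn_Icc
  rw [← integrableOn_univ]
  refine ((h3.union h4).union h1).mono_set fun x _ => ?_
  rcases lt_or_ge x (-S) with h | h
  · exact Or.inl (Or.inl h)
  · rcases le_or_gt x S with h' | h'
    · exact Or.inl (Or.inr ⟨h, h'⟩)
    · exact Or.inr h'

/-- Otherwise h(t) + h(-t) ≥ ε on a half-line, contradicting integrability. Adding the two values is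
what gives smallness at T and -T simultaneously. -/
theorem frequently_lt_of_integrable {h : ℝ → ℝ} (hi : Integrable h) (h0 : ∀ t, 0 ≤ h t) {ε : ℝ}
    (hε : 0 < ε) : ∃ᶠ T in atTop, h T < ε ∧ h (-T) < ε := by
  have hi2 : Integrable fun t => h t + h (-t) := hi.add hi.comp_neg
  intro hev
  obtain ⟨T, hT⟩ := eventually_atTop.1 hev
  have hle : ∀ t ∈ Set.Ioi T, ε ≤ h t + h (-t) := by
    intro t ht
    by_contra hcon
    push Not at hcon
    exact hT t (le_of_lt ht) ⟨by linarith [h0 (-t)], by linarith [h0 t]⟩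
  have : IntegrableOn (fun _ : ℝ => ε) (Set.Ioi T) := by
    refine hi2.integrableOn.mono' aestronglyMeasurable_const ?_
    refine (ae_restrict_iff' measurableSet_Ioi).2 (Eventually.of_forall fun t ht => ?_)
    rw [Real.norm_eq_abs, abs_of_pos hε]
    exact hle t ht
  rw [integrableOn_const_iff] at this
  rcases this with h | h
  · simp [hε.ne'] at h
  · simp at h

/-- All the poles are real, so separation constrains the path only where it crosses the real axis,
and the rightmost pole -1/2 decides. -/
theorem IsMeijerPath.neg_half_lt {r : ℕ} {a : List ℂ} {γ : ℝ → ℝ}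
    (h : IsMeijerPath 0 (r + 1) (List.replicate (r + 1) (1 / 2 : ℂ) ++ a) [] γ) :
    -(1 / 2) < γ 0 := by
  have := h.left (1 / 2) (by rw [List.take_left' (by simp)]; simp) 0
  norm_num at this
  linarith

theorem isMeijerPath_of_neg_half_lt {r : ℕ} {a : List ℂ} {γ : ℝ → ℝ} (h1 : ContDiff ℝ 1 γ)
    (h2 : ∃ M : ℝ, ∀ t, |γ t| ≤ M) (h3 : -(1 / 2) < γ 0) :
    IsMeijerPath 0 (r + 1) (List.replicate (r + 1) (1 / 2 : ℂ) ++ a) [] γ where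
  contDiff := h1
  bounded := h2
  left c hc k := by
    rw [List.take_left' (by simp)] at hc
    obtain rfl := List.eq_of_mem_replicate hc
    have : (0 : ℝ) ≤ k := Nat.cast_nonneg k
    norm_num
    linarith
  right c hc := by simp at hc

/-- The velocity has imaginary part 1, so the pullback dominates the integrand even where the slope
is uncontrolled. -/
theorem norm_le_norm_mul_deriv_add_I (w : ℂ) (d : ℝ) : ‖w‖ ≤ ‖w * ((d : ℂ) + Complex.I)‖ := by
  rw [norm_mul]
  refine le_mul_of_one_le_right (norm_nonneg _) ?_
  have := Complex.abs_im_le_norm ((d : ℂ) + Complex.I)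
  simpa using this

/-- The paths may wander left of -1/2 away from the real axis; the slit plane still contains
everything between them, since the cut lies on that axis. -/
theorem mem_gammaSlit_of_between {γ₀ γ₁ : ℝ → ℝ} (h₀ : -(1 / 2) < γ₀ 0) (h₁ : -(1 / 2) < γ₁ 0) (t : ℝ)
    (σ : ℝ) (hσ : σ ∈ Set.uIcc (γ₀ t) (γ₁ t)) : (σ : ℂ) + (t : ℂ) * Complex.I ∈ gammaSlit := by
  by_cases ht : t = 0
  · subst ht
    refine mem_gammaSlit_of_re ?_
    have := hσ.1
    have h := lt_min h₀ h₁
    simpa using lt_of_lt_of_le h this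
  · exact mem_gammaSlit_of_im (by simpa using ht)

theorem integral_besselKernel_path_eq (ρ : ℝ) (r : ℕ) {z : ℝ} (hz : 0 < z) {γ₀ γ₁ : ℝ → ℝ}
    (hc₀ : ContDiff ℝ 1 γ₀) (hc₁ : ContDiff ℝ 1 γ₁) (hb₀ : ∃ M : ℝ, ∀ t, |γ₀ t| ≤ M)
    (hb₁ : ∃ M : ℝ, ∀ t, |γ₁ t| ≤ M) (h₀ : -(1 / 2) < γ₀ 0) (h₁ : -(1 / 2) < γ₁ 0)
    (hi₀ : Integrable fun t => besselKernel ρ r (meijerPath γ₀ t) * (z : ℂ) ^ meijerPath γ₀ t *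
      (((deriv γ₀ t : ℝ) : ℂ) + Complex.I))
    (hi₁ : Integrable fun t => besselKernel ρ r (meijerPath γ₁ t) * (z : ℂ) ^ meijerPath γ₁ t *
      (((deriv γ₁ t : ℝ) : ℂ) + Complex.I)) :
    ∫ t, besselKernel ρ r (meijerPath γ₀ t) * (z : ℂ) ^ meijerPath γ₀ t *
        (((deriv γ₀ t : ℝ) : ℂ) + Complex.I) =
      ∫ t, besselKernel ρ r (meijerPath γ₁ t) * (z : ℂ) ^ meijerPath γ₁ t *
        (((deriv γ₁ t : ℝ) : ℂ) + Complex.I) := by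
  obtain ⟨M₀, hM₀⟩ := hb₀
  obtain ⟨M₁, hM₁⟩ := hb₁
  set M := max M₀ M₁ with hM
  obtain ⟨C, hC0, hC⟩ := exists_norm_besselKernel_bounds ρ r M
  have hzc : (z : ℂ) ≠ 0 := by exact_mod_cast hz.ne'
  have hz_norm : ∀ σ t : ℝ, ‖(z : ℂ) ^ ((σ : ℂ) + t * Complex.I)‖ = z ^ σ := by
    intro σ t
    rw [Complex.norm_cpow_eq_rpow_re_of_pos hz]
    simp
  -- For fixed `t` the size of the integrand is a constant times X^σ with X = |t|^(2(r+1)) z, the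
  -- form needed for comparison with the endpoints.
  have hexp : ∀ σ t : ℝ, 1 ≤ |t| → |t| ^ besselExponent ρ r σ * z ^ σ =
      |t| ^ ((r + 1) / 2 - ρ - 1) * (|t| ^ (2 * ((r : ℝ) + 1)) * z) ^ σ := by
    intro σ t ht
    have hT : 0 < |t| := by linarith
    rw [besselExponent, Real.rpow_add hT, Real.mul_rpow (by positivity) hz.le, ← Real.rpow_mul hT.le]
    ring
  set p₀ := fun t => besselKernel ρ r (meijerPath γ₀ t) * (z : ℂ) ^ meijerPath γ₀ t *
      (((deriv γ₀ t : ℝ) : ℂ) + Complex.I) with hp₀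
  set p₁ := fun t => besselKernel ρ r (meijerPath γ₁ t) * (z : ℂ) ^ meijerPath γ₁ t *
      (((deriv γ₁ t : ℝ) : ℂ) + Complex.I) with hp₁
  have hlow : ∀ σ t : ℝ, |σ| ≤ M → 1 ≤ |t| →
      |t| ^ besselExponent ρ r σ * z ^ σ ≤ C * ‖besselKernel ρ r ((σ : ℂ) + t * Complex.I) *
        (z : ℂ) ^ ((σ : ℂ) + t * Complex.I)‖ := by
    intro σ t hσ ht
    rw [norm_mul, hz_norm, ← mul_assoc]
    exact mul_le_mul_of_nonneg_right (hC σ t hσ ht).2 (by positivity)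
  refine integral_path_eq_of_horizontal_small (f := fun s => besselKernel ρ r s * (z : ℂ) ^ s)
    (M := 2 * M) (h := fun t => C * (C * (‖p₀ t‖ + ‖p₁ t‖)))
    hc₀ hc₁ isOpen_gammaSlit ?_ (mem_gammaSlit_of_between h₀ h₁) hi₀ hi₁ ?_ ?_ ?_
  · refine (differentiableOn_besselKernel ρ r).mul ?_
    exact (differentiable_id.const_cpow (Or.inl hzc)).differentiableOn
  · intro t
    refine (abs_sub _ _).trans ?_
    linarith [hM₀ t, hM₁ t, le_max_left M₀ M₁, le_max_right M₀ M₁]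
  · intro t ht σ hσ
    have hσM : |σ| ≤ M := by
      have a0 := abs_le.mp ((hM₀ t).trans (le_max_left M₀ M₁))
      have a1 := abs_le.mp ((hM₁ t).trans (le_max_right M₀ M₁))
      exact abs_le.mpr ⟨(le_min a0.1 a1.1).trans hσ.1, hσ.2.trans (max_le a0.2 a1.2)⟩
    have hT : 0 < |t| := by linarith
    rw [norm_mul, hz_norm]
    calc _ ≤ C * |t| ^ besselExponent ρ r σ * z ^ σ :=
          mul_le_mul_of_nonneg_right (hC σ t hσM ht).1 (by positivity)
      _ = C * (|t| ^ ((r + 1) / 2 - ρ - 1) * (|t| ^ (2 * ((r : ℝ) + 1)) * z) ^ σ) := by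
          rw [mul_assoc, hexp σ t ht]
      _ ≤ C * (|t| ^ ((r + 1) / 2 - ρ - 1) * ((|t| ^ (2 * ((r : ℝ) + 1)) * z) ^ γ₀ t +
            (|t| ^ (2 * ((r : ℝ) + 1)) * z) ^ γ₁ t)) := by
          gcongr
          exact rpow_le_add_of_mem_uIcc (by positivity) hσ
      _ = C * (|t| ^ besselExponent ρ r (γ₀ t) * z ^ γ₀ t + |t| ^ besselExponent ρ r (γ₁ t) * z ^ γ₁ t) := by
          rw [mul_add, ← hexp _ t ht, ← hexp _ t ht]
      _ ≤ C * (C * ‖p₀ t‖ + C * ‖p₁ t‖) := by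
          refine mul_le_mul_of_nonneg_left (add_le_add ?_ ?_) hC0.le
          · refine (hlow _ t ((hM₀ t).trans (le_max_left M₀ M₁)) ht).trans ?_
            exact mul_le_mul_of_nonneg_left (norm_le_norm_mul_deriv_add_I _ _) hC0.le
          · refine (hlow _ t ((hM₁ t).trans (le_max_right M₀ M₁)) ht).trans ?_
            exact mul_le_mul_of_nonneg_left (norm_le_norm_mul_deriv_add_I _ _) hC0.le
      _ = _ := by ring
  · intro ε hε
    exact frequently_lt_of_integrable (((hi₀.norm.add hi₁.norm).const_mul C).const_mul C)
      (fun t => by simp only [Pi.add_apply]; positivity) hε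

theorem continuous_besselKernel_path (ρ : ℝ) (r : ℕ) {γ : ℝ → ℝ} (hc : Continuous γ)
    (h0 : -(1 / 2) < γ 0) : Continuous fun t => besselKernel ρ r (meijerPath γ t) := by
  refine ((differentiableOn_besselKernel ρ r).continuousOn).comp_continuous (continuous_meijerPath hc) fun t => ?_
  exact mem_gammaSlit_of_between h0 h0 t (γ t) Set.left_mem_uIcc

theorem integrable_besselKernel_line (ρ : ℝ) (r : ℕ) {σ : ℝ} (h1 : -(1 / 2) < σ)
    (h2 : besselExponent ρ r σ < -1) :
    Integrable fun t : ℝ => besselKernel ρ r (meijerPath (fun _ => σ) t) := by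
  obtain ⟨C, hC0, hC⟩ := exists_norm_besselKernel_bounds ρ r |σ|
  exact integrable_of_norm_le_rpow (continuous_besselKernel_path ρ r continuous_const h1) h2
    (fun t ht => (hC σ t le_rfl ht).1)

theorem norm_cpow_meijerPath {z : ℝ} (hz : 0 < z) (γ : ℝ → ℝ) (t : ℝ) :
    ‖(z : ℂ) ^ meijerPath γ t‖ = z ^ γ t := by
  rw [Complex.norm_cpow_eq_rpow_re_of_pos hz]
  simp [meijerPath]

theorem continuous_cpow_meijerPath {z : ℝ} (hz : 0 < z) {γ : ℝ → ℝ} (h : Continuous γ) :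
    Continuous fun t => (z : ℂ) ^ meijerPath γ t :=
  (continuous_meijerPath h).const_cpow (Or.inl (by exact_mod_cast hz.ne'))

theorem integrable_besselKernel_mul_cpow_line (ρ : ℝ) (r : ℕ) {σ : ℝ} (h1 : -(1 / 2) < σ)
    (h2 : besselExponent ρ r σ < -1) {z : ℝ} (hz : 0 < z) :
    Integrable fun t : ℝ => besselKernel ρ r (meijerPath (fun _ => σ) t) *
      (z : ℂ) ^ meijerPath (fun _ => σ) t := by
  refine (integrable_besselKernel_line ρ r h1 h2).mul_bdd (c := z ^ σ)
    (continuous_cpow_meijerPath hz continuous_const).aestronglyMeasurable ?_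
  exact Eventually.of_forall fun t => (norm_cpow_meijerPath hz _ t).le

/-- The Meijer function of the theorem is given by the integral along any vertical line between
the poles and the abscissa of absolute convergence. -/
theorem hasMeijerG_line (ρ : ℝ) (r : ℕ) {σ : ℝ} (h1 : -(1 / 2) < σ)
    (h2 : besselExponent ρ r σ < -1) {z : ℝ} (hz : 0 < z) :
    HasMeijerG 0 (r + 1)
      (List.replicate (r + 1) (1 / 2 : ℂ) ++ [(ρ : ℂ) + 1] ++ List.replicate r (0 : ℂ)) [] (z : ℂ)
      (1 / (2 * (Real.pi : ℂ)) * ∫ t : ℝ, besselKernel ρ r (meijerPath (fun _ => σ) t) *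
        (z : ℂ) ^ meijerPath (fun _ => σ) t) := by
  have hpb : ∀ γ : ℝ → ℝ, meijerPullback 0 (r + 1)
      (List.replicate (r + 1) (1 / 2 : ℂ) ++ [(ρ : ℂ) + 1] ++ List.replicate r (0 : ℂ)) [] (z : ℂ) γ =
      fun t => besselKernel ρ r (meijerPath γ t) * (z : ℂ) ^ meijerPath γ t *
        (((deriv γ t : ℝ) : ℂ) + Complex.I) := by
    intro γ
    ext t
    rw [meijerPullback, meijerIntegrand_eq_besselKernel]
  have hint : Integrable fun t => besselKernel ρ r (meijerPath (fun _ => σ) t) *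
      (z : ℂ) ^ meijerPath (fun _ => σ) t * (((deriv (fun _ => σ) t : ℝ) : ℂ) + Complex.I) := by
    simpa using (integrable_besselKernel_mul_cpow_line ρ r h1 h2 hz).mul_const Complex.I
  refine ⟨⟨fun _ => σ, ?_, ?_⟩, fun γ hγ hi => ?_⟩
  · rw [List.append_assoc]
    exact isMeijerPath_of_neg_half_lt contDiff_const ⟨|σ|, fun _ => le_rfl⟩ h1
  · rw [hpb]
    exact hint
  · rw [hpb] at hi ⊢
    rw [List.append_assoc] at hγ
    rw [integral_besselKernel_path_eq ρ r hz hγ.contDiff contDiff_const hγ.bounded ⟨|σ|, fun _ => le_rfl⟩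
      hγ.neg_half_lt h1 hi hint]
    simp only [deriv_const, Complex.ofReal_zero, zero_add]
    rw [integral_mul_const]
    have := Complex.I_ne_zero
    field_simp

/-! ### Crossing a simple pole. -/

theorem integral_inv_add_mul_I {δ : ℝ} (hδ : δ ≠ 0) (T : ℝ) :
    ∫ t in -T..T, ((δ : ℂ) + (t : ℂ) * Complex.I)⁻¹ = ((2 * Real.arctan (T / δ) : ℝ) : ℂ) := by
  have hne : ∀ t : ℝ, (δ : ℂ) + (t : ℂ) * Complex.I ≠ 0 := by
    intro t h
    exact hδ (by simpa using congrArg Complex.re h)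
  have hd : ∀ t : ℝ, HasDerivAt (fun t : ℝ => ((Real.arctan (t / δ) : ℝ) : ℂ) -
      Complex.I / 2 * ((Real.log (δ ^ 2 + t ^ 2) : ℝ) : ℂ)) ((δ : ℂ) + (t : ℂ) * Complex.I)⁻¹ t := by
    intro t
    have hp : 0 < δ ^ 2 + t ^ 2 := by positivity
    have h1 := (((hasDerivAt_id t).div_const δ).arctan).ofReal_comp
    have h2 := ((((hasDerivAt_id t).pow 2).const_add (δ ^ 2)).log hp.ne').ofReal_comp.const_mul
      (Complex.I / 2)
    refine (h1.sub h2).congr_deriv ?_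
    have hpc : (δ : ℂ) ^ 2 + (t : ℂ) ^ 2 ≠ 0 := by exact_mod_cast hp.ne'
    have hδc : (δ : ℂ) ≠ 0 := by exact_mod_cast hδ
    have hinv : ((δ : ℂ) + (t : ℂ) * Complex.I)⁻¹ = (δ - t * Complex.I) / ((δ : ℂ) ^ 2 + (t : ℂ) ^ 2) := by
      rw [inv_eq_one_div, div_eq_div_iff (hne t) hpc]
      ring_nf
      rw [Complex.I_sq]
      ring
    have h3 : (1 : ℂ) + ((t : ℂ) / δ) ^ 2 = ((δ : ℂ) ^ 2 + (t : ℂ) ^ 2) / (δ : ℂ) ^ 2 := by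
      field_simp
    rw [hinv]
    simp only [id]
    push_cast
    rw [h3]
    field_simp
    simp
    field_simp
  rw [intervalIntegral.integral_eq_sub_of_hasDerivAt (fun t _ => hd t)]
  · rw [neg_div, Real.arctan_neg, neg_sq]
    push_cast
    ring
  · apply Continuous.intervalIntegrable
    exact Continuous.inv₀ (by fun_prop) hne

/-- The symmetric limits on the two sides of the pole differ by 2π; this jump is the whole residue
contribution. -/
theorem tendsto_integral_inv_add_mul_I {δ : ℝ} (hδ : δ ≠ 0) :
    Tendsto (fun T : ℝ => ∫ t in -T..T, ((δ : ℂ) + (t : ℂ) * Complex.I)⁻¹) atTop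
      (𝓝 ((SignType.sign δ : ℝ) * Real.pi : ℝ)) := by
  simp only [integral_inv_add_mul_I hδ]
  refine (Complex.continuous_ofReal.tendsto _).comp ?_
  rcases lt_or_gt_of_ne hδ with h | h
  · have := ((Real.tendsto_arctan_atBot.mono_right nhdsWithin_le_nhds).comp
      (tendsto_id.atTop_mul_const_of_neg (inv_lt_zero.2 h))).const_mul 2
    simp only [sign_neg h]
    convert this using 1
    · funext T
      simp [div_eq_mul_inv]
    · congr 1
      simp
      ring
  · have := ((Real.tendsto_arctan_atTop.mono_right nhdsWithin_le_nhds).comp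
      (tendsto_id.atTop_mul_const (inv_pos.2 h))).const_mul 2
    simp only [sign_pos h]
    convert this using 1
    · funext T
      simp [div_eq_mul_inv]
    · congr 1
      simp
      ring

/-- Moving a vertical line of integration across a simple pole. -/
theorem integral_line_sub_integral_line_eq {q : ℂ → ℂ} {p a b σ₁ σ₂ : ℝ} (ha : a < σ₂) (h₂ : σ₂ < p)
    (h₁ : p < σ₁) (hb : σ₁ < b) (hq : DifferentiableOn ℂ q {s | a < s.re ∧ s.re < b})
    (hi₁ : Integrable fun t : ℝ => q (σ₁ + t * Complex.I) / (σ₁ + t * Complex.I - p))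
    (hi₂ : Integrable fun t : ℝ => q (σ₂ + t * Complex.I) / (σ₂ + t * Complex.I - p)) {h : ℝ → ℝ}
    (hh : ∀ t : ℝ, 1 ≤ |t| → ∀ σ ∈ Set.Icc σ₂ σ₁,
      ‖q (σ + t * Complex.I) / (σ + t * Complex.I - p)‖ ≤ h t)
    (hlim : Tendsto h atTop (𝓝 0)) (hlim' : Tendsto (fun t => h (-t)) atTop (𝓝 0)) :
    (∫ t : ℝ, q (σ₁ + t * Complex.I) / (σ₁ + t * Complex.I - p)) -
      (∫ t : ℝ, q (σ₂ + t * Complex.I) / (σ₂ + t * Complex.I - p)) = 2 * Real.pi * q p := by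
  set U : Set ℂ := {s | a < s.re ∧ s.re < b} with hU
  have hUo : IsOpen U := (isOpen_lt continuous_const Complex.continuous_re).inter
    (isOpen_lt Complex.continuous_re continuous_const)
  have hpU : U ∈ 𝓝 (p : ℂ) := hUo.mem_nhds ⟨by simp; linarith, by simp; linarith⟩
  -- Subtracting q(p)/(s-p) leaves the holomorphic `dslope`, to which Cauchy's theorem applies; the
  -- subtracted term is integrated explicitly.
  have hF : DifferentiableOn ℂ (dslope q p) U := (Complex.differentiableOn_dslope hpU).2 hq
  have hFeq : ∀ σ t : ℝ, (σ : ℂ) + t * Complex.I ≠ p → dslope q p (σ + t * Complex.I) =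
      q (σ + t * Complex.I) / (σ + t * Complex.I - p) -
        q p * (((σ - p : ℝ) : ℂ) + t * Complex.I)⁻¹ := by
    intro σ t hne
    rw [dslope_of_ne _ hne, slope_def_field, sub_div, div_eq_mul_inv (q p)]
    congr 3
    push_cast
    ring
  have hne : ∀ {σ : ℝ}, σ ≠ p → ∀ t : ℝ, (σ : ℂ) + t * Complex.I ≠ p := by
    intro σ hσ t hc
    exact hσ (by simpa using congrArg Complex.re hc)
  set H : ℝ → ℂ := fun t => ∫ σ in σ₂..σ₁, dslope q p ((σ : ℂ) + (t : ℂ) * Complex.I) with hH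
  have hσ : σ₂ ≤ σ₁ := by linarith
  have hmem : ∀ t : ℝ, ∀ σ ∈ Set.uIcc σ₂ σ₁, (σ : ℂ) + (t : ℂ) * Complex.I ∈ U := by
    intro t σ hσ'
    rw [Set.uIcc_of_le hσ] at hσ'
    exact ⟨by simp; linarith [hσ'.1], by simp; linarith [hσ'.2]⟩
  have hcont : ∀ σ ∈ Set.uIcc σ₂ σ₁, Continuous fun t : ℝ => dslope q p ((σ : ℂ) + (t : ℂ) * Complex.I) :=
    fun σ hσ => hF.continuousOn.comp_continuous (by fun_prop) fun t => hmem t σ hσ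
  have hFTC : ∀ T : ℝ, (∫ t in -T..T, dslope q p ((σ₁ : ℂ) + (t : ℂ) * Complex.I)) -
      (∫ t in -T..T, dslope q p ((σ₂ : ℂ) + (t : ℂ) * Complex.I)) =
        (H T - H (-T)) * (Complex.I)⁻¹ := by
    intro T
    have hd := fun t => hasDerivAt_horizontal_integral (γ₀ := fun _ => σ₂) (γ₁ := fun _ => σ₁)
      contDiff_const contDiff_const hUo hF t (hmem t)
    simp only [meijerPath, deriv_const, Complex.ofReal_zero, zero_add] at hd
    have hc1 := hcont σ₁ Set.right_mem_uIcc
    have hc2 := hcont σ₂ Set.left_mem_uIcc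
    have := intervalIntegral.integral_eq_sub_of_hasDerivAt (a := -T) (b := T) (fun t _ => hd t)
      (Continuous.intervalIntegrable (by fun_prop) _ _)
    rw [intervalIntegral.integral_sub (Continuous.intervalIntegrable (by fun_prop) _ _)
      (Continuous.intervalIntegrable (by fun_prop) _ _), intervalIntegral.integral_mul_const,
      intervalIntegral.integral_mul_const, ← sub_mul] at this
    rw [hH, ← this, mul_assoc, mul_inv_cancel₀ Complex.I_ne_zero, mul_one]
  have hHb : ∀ t : ℝ, 1 ≤ |t| → ‖H t‖ ≤ (h t + ‖q p‖ * |t|⁻¹) * |σ₁ - σ₂| := by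
    intro t ht
    refine intervalIntegral.norm_integral_le_of_norm_le_const fun σ hσ' => ?_
    rw [Set.uIoc_of_le hσ] at hσ'
    have ht0 : t ≠ 0 := fun h0 => by simp [h0] at ht; linarith
    have hn : (σ : ℂ) + t * Complex.I ≠ p := by
      intro hc
      exact ht0 (by simpa using congrArg Complex.im hc)
    rw [hFeq σ t hn]
    refine (norm_sub_le _ _).trans (add_le_add (hh t ht σ ⟨hσ'.1.le, hσ'.2⟩) ?_)
    rw [norm_mul, norm_inv]
    gcongr
    simpa using Complex.abs_im_le_norm (((σ - p : ℝ) : ℂ) + t * Complex.I)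
  have hinv : Tendsto (fun t : ℝ => |t|⁻¹) atTop (𝓝 0) := tendsto_inv_atTop_zero.comp tendsto_abs_atTop_atTop
  have hHT : Tendsto H atTop (𝓝 0) := by
    refine squeeze_zero_norm' ?_ (by simpa using (hlim.add (hinv.const_mul ‖q p‖)).mul_const |σ₁ - σ₂|)
    filter_upwards [eventually_ge_atTop 1] with t ht
    exact hHb t (ht.trans (le_abs_self t))
  have hHT' : Tendsto (fun t => H (-t)) atTop (𝓝 0) := by
    refine squeeze_zero_norm' ?_ (by simpa using (hlim'.add (hinv.const_mul ‖q p‖)).mul_const |σ₁ - σ₂|)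
    filter_upwards [eventually_ge_atTop 1] with t ht
    simpa using hHb (-t) (by rw [abs_neg]; exact ht.trans (le_abs_self t))
  have hline : ∀ {σ : ℝ}, σ ∈ Set.uIcc σ₂ σ₁ → σ ≠ p →
      (Integrable fun t : ℝ => q (σ + t * Complex.I) / (σ + t * Complex.I - p)) →
      Tendsto (fun T : ℝ => ∫ t in -T..T, dslope q p ((σ : ℂ) + (t : ℂ) * Complex.I)) atTop
        (𝓝 ((∫ t : ℝ, q (σ + t * Complex.I) / (σ + t * Complex.I - p)) -
          q p * ((SignType.sign (σ - p) : ℝ) * Real.pi : ℝ))) := by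
    intro σ hσ hσp hi
    have hci : Continuous fun t : ℝ => (((σ - p : ℝ) : ℂ) + t * Complex.I)⁻¹ := by
      refine Continuous.inv₀ (by fun_prop) fun t h0 => ?_
      exact sub_ne_zero.2 hσp (by simpa using congrArg Complex.re h0)
    have h1 := intervalIntegral_tendsto_integral hi tendsto_neg_atTop_atBot tendsto_id
    have h2 := (tendsto_integral_inv_add_mul_I (sub_ne_zero.2 hσp)).const_mul (q p)
    refine (h1.sub h2).congr fun T => ?_
    rw [← intervalIntegral.integral_const_mul, id_eq, ← intervalIntegral.integral_sub hi.intervalIntegrable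
      ((hci.const_mul _).intervalIntegrable _ _)]
    exact intervalIntegral.integral_congr fun t _ => (hFeq σ t (hne hσp t)).symm
  have l1 := hline Set.right_mem_uIcc h₁.ne' hi₁
  have l2 := hline Set.left_mem_uIcc h₂.ne hi₂
  have l3 := (l1.sub l2).congr hFTC
  have l4 := tendsto_nhds_unique l3 ((hHT.sub hHT').mul_const _)
  rw [sign_pos (sub_pos.2 h₁), sign_neg (sub_neg.2 h₂)] at l4
  simp at l4
  linear_combination l4

/-! ### The Bessel function as a sum of residues. -/

theorem Gamma_add_natCast_eq {s : ℂ} (n : ℕ) (h : ∀ j : ℕ, s + j ≠ 0) :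
    Complex.Gamma (s + n) = (∏ j ∈ Finset.range n, (s + j)) * Complex.Gamma s := by
  induction n with
  | zero => simp
  | succ n ih =>
    rw [Nat.cast_succ, ← add_assoc, Complex.Gamma_add_one _ (h n), ih, Finset.prod_range_succ]
    ring

theorem prod_range_natCast_sub_self (n : ℕ) :
    ∏ j ∈ Finset.range n, ((j : ℂ) - n) = (-1) ^ n * (n.factorial : ℂ) := by
  have h1 : ∏ j ∈ Finset.range n, ((n : ℂ) - j) = (n.factorial : ℂ) := by
    rw [← Nat.descFactorial_self, Nat.descFactorial_eq_prod_range, Nat.cast_prod]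
    refine Finset.prod_congr rfl fun j hj => ?_
    rw [Nat.cast_sub (Finset.mem_range.1 hj).le]
  rw [← h1, ← Finset.card_range n, ← Finset.prod_const, Finset.card_range, ← Finset.prod_mul_distrib]
  exact Finset.prod_congr rfl fun j _ => by ring

/-- The integrand `Γ(1/2 + s) / Γ(ρ + 1 - s) z^s` with its pole at `-1/2 - n` removed. -/
noncomputable def besselResidueNumerator (ρ z : ℝ) (n : ℕ) (s : ℂ) : ℂ :=
  Complex.Gamma (1 / 2 + s + (n + 1 : ℕ)) / (∏ j ∈ Finset.range n, (1 / 2 + s + (j : ℂ))) *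
    (Complex.Gamma ((ρ : ℂ) + 1 - s))⁻¹ * (z : ℂ) ^ s

theorem besselResidueNumerator_div (ρ z : ℝ) (n : ℕ) {s : ℂ} (h : ∀ j : ℕ, 1 / 2 + s + (j : ℂ) ≠ 0) :
    besselResidueNumerator ρ z n s / (s - ((-(1 / 2) - n : ℝ) : ℂ)) =
      besselKernel ρ 0 s * (z : ℂ) ^ s := by
  have h1 : s - ((-(1 / 2) - n : ℝ) : ℂ) = 1 / 2 + s + n := by push_cast; ring
  have h2 : ∏ j ∈ Finset.range n, (1 / 2 + s + (j : ℂ)) ≠ 0 := Finset.prod_ne_zero_iff.2 fun j _ => h j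
  have h3 := h n
  rw [besselResidueNumerator, besselKernel, h1, Gamma_add_natCast_eq _ h, Finset.prod_range_succ]
  generalize ∏ j ∈ Finset.range n, (1 / 2 + s + (j : ℂ)) = P at *
  generalize 1 / 2 + s + (n : ℂ) = Q at *
  field_simp
  simp
  ring

/-- The strip ends at the neighbouring poles -3/2-n and 1/2-n: the first belongs to the shifted
Gamma function, the second is the nearest zero of the product (when n > 0). -/
theorem differentiableOn_besselResidueNumerator (ρ : ℝ) {z : ℝ} (hz : 0 < z) (n : ℕ) :
    DifferentiableOn ℂ (besselResidueNumerator ρ z n)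
      {s | -(3 / 2) - (n : ℝ) < s.re ∧ s.re < 1 / 2 - (n : ℝ)} := by
  rintro s ⟨h1, h2⟩
  apply DifferentiableAt.differentiableWithinAt
  have d1 : DifferentiableAt ℂ (fun s : ℂ => Complex.Gamma (1 / 2 + s + (n + 1 : ℕ))) s := by
    refine DifferentiableAt.comp (g := Complex.Gamma) s ?_ (by fun_prop)
    refine Complex.differentiableAt_Gamma _ fun m hm => ?_
    have := congrArg Complex.re hm
    have hm0 : (0 : ℝ) ≤ m := Nat.cast_nonneg m
    simp at this
    linarith
  have d2 : DifferentiableAt ℂ (fun s : ℂ => ∏ j ∈ Finset.range n, (1 / 2 + s + (j : ℂ))) s := by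
    fun_prop
  have d3 : DifferentiableAt ℂ (fun s : ℂ => (Complex.Gamma ((ρ : ℂ) + 1 - s))⁻¹) s :=
    (Complex.differentiable_one_div_Gamma _).comp s (by fun_prop)
  have d4 : DifferentiableAt ℂ (fun s : ℂ => (z : ℂ) ^ s) s :=
    differentiableAt_id.const_cpow (Or.inl (by exact_mod_cast hz.ne'))
  refine ((d1.div d2 ?_).mul d3).mul d4
  refine Finset.prod_ne_zero_iff.2 fun j hj h0 => ?_
  have := congrArg Complex.re h0
  have hj' : (j : ℝ) + 1 ≤ n := by exact_mod_cast Finset.mem_range.1 hj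
  simp at this
  linarith

/-- At the pole the shifted Gamma factor is Γ(1) and the product is (-1)^n n!, which leaves the n-th
Bessel coefficient. -/
theorem besselResidueNumerator_apply_pole (ρ : ℝ) {z : ℝ} (hz : 0 < z) (n : ℕ) :
    besselResidueNumerator ρ z n ((-(1 / 2) - n : ℝ) : ℂ) =
      (((-1) ^ n / ((n.factorial : ℝ) * Real.Gamma (n + (ρ + 1 / 2) + 1)) * z ^ (-(1 / 2) - n : ℝ) : ℝ) : ℂ) := by
  have h1 : (1 / 2 : ℂ) + ((-(1 / 2) - n : ℝ) : ℂ) = -n := by push_cast; ring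
  have h2 : (ρ : ℂ) + 1 - ((-(1 / 2) - n : ℝ) : ℂ) = ((n + (ρ + 1 / 2) + 1 : ℝ) : ℂ) := by push_cast; ring
  have h3 : ∀ j ∈ Finset.range n, (-(n : ℂ) + (j : ℂ)) = (j : ℂ) - n := fun j _ => by ring
  rw [besselResidueNumerator, h1, h2, Finset.prod_congr rfl h3, prod_range_natCast_sub_self,
    Complex.Gamma_ofReal, ← Complex.ofReal_cpow hz.le]
  have h4 : -(n : ℂ) + ((n + 1 : ℕ) : ℂ) = 1 := by push_cast; ring
  rw [h4, Complex.Gamma_one]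
  push_cast
  have h5 : ((-1 : ℂ) ^ n) * (-1) ^ n = 1 := by rw [← mul_pow]; simp
  have h6 : ((-1 : ℂ) ^ n) ≠ 0 := by simp
  have : (1 : ℂ) / ((-1) ^ n * (n.factorial : ℂ)) = (-1) ^ n / (n.factorial : ℂ) := by
    rw [div_mul_eq_div_div, one_div, eq_comm]
    congr 1
    exact eq_inv_of_mul_eq_one_left h5
  rw [this, div_mul_eq_div_div, div_eq_mul_inv _ ((Real.Gamma _ : ℝ) : ℂ)]

theorem besselKernel_zero_sub_one (ρ : ℝ) {s : ℂ} (h1 : s - 1 / 2 ≠ 0) (h2 : (ρ : ℂ) + 1 - s ≠ 0) :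
    besselKernel ρ 0 (s - 1) = besselKernel ρ 0 s / ((s - 1 / 2) * ((ρ : ℂ) + 1 - s)) := by
  have e1 : (1 : ℂ) / 2 + s = (s - 1 / 2) + 1 := by ring
  have e2 : (ρ : ℂ) + 1 - (s - 1) = ((ρ : ℂ) + 1 - s) + 1 := by ring
  have e3 : (1 : ℂ) / 2 + (s - 1) = s - 1 / 2 := by ring
  simp only [besselKernel, zero_add, pow_one, pow_zero, mul_one]
  rw [e1, e2, e3, Complex.Gamma_add_one _ h1, Complex.Gamma_add_one _ h2, mul_inv]
  generalize s - 1 / 2 = w at h1 ⊢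
  field_simp

/-- `besselKernel ρ 0 s * z ^ s` on the vertical line with abscissa `σ - n`. -/
noncomputable def besselLine (ρ z σ : ℝ) (n : ℕ) (t : ℝ) : ℂ :=
  besselKernel ρ 0 (((σ - n : ℝ) : ℂ) + t * Complex.I) * (z : ℂ) ^ (((σ - n : ℝ) : ℂ) + t * Complex.I)

/-- Moving left by 1 divides the integrand by z(s-1/2)(ρ+1-s), by the functional equation. Both
linear factors are at least (n+1)/2 in norm, so their product is at least (n+1)/4, which already
yields factorial decay. -/
theorem norm_besselLine_le {ρ z σ : ℝ} (hz : 0 < z) (h1 : σ < 0) (hρ : -(1 / 2) < ρ) (n : ℕ) (t : ℝ) :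
    ‖besselLine ρ z σ n t‖ ≤ ‖besselLine ρ z σ 0 t‖ * ((4 / z) ^ n / (n.factorial : ℝ)) := by
  induction n with
  | zero => simp
  | succ n ih =>
    set s : ℂ := ((σ - n : ℝ) : ℂ) + t * Complex.I with hs
    have hn0 : (0 : ℝ) ≤ n := Nat.cast_nonneg n
    have hzc : (z : ℂ) ≠ 0 := by exact_mod_cast hz.ne'
    have hs' : ((σ - (n + 1 : ℕ) : ℝ) : ℂ) + t * Complex.I = s - 1 := by
      rw [hs]; push_cast; ring
    have hre : s.re = σ - n := by simp [hs]
    have b1 : ((n : ℝ) + 1) / 2 ≤ ‖s - 1 / 2‖ := by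
      have := (neg_le_abs _).trans (Complex.abs_re_le_norm (s - 1 / 2))
      simp [hre] at this
      linarith
    have b2 : ((n : ℝ) + 1) / 2 ≤ ‖(ρ : ℂ) + 1 - s‖ := by
      have := (le_abs_self _).trans (Complex.abs_re_le_norm ((ρ : ℂ) + 1 - s))
      simp [hre] at this
      linarith
    have hpos : 0 < ((n : ℝ) + 1) / 2 := by positivity
    have e : besselLine ρ z σ (n + 1) t =
        besselLine ρ z σ n t / ((s - 1 / 2) * ((ρ : ℂ) + 1 - s)) * (z : ℂ)⁻¹ := by
      rw [besselLine, besselLine, hs', besselKernel_zero_sub_one ρ (norm_pos_iff.1 (hpos.trans_le b1))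
        (norm_pos_iff.1 (hpos.trans_le b2)), Complex.cpow_sub _ _ hzc, Complex.cpow_one, ← hs]
      ring
    rw [e, norm_mul, norm_div, norm_mul, norm_inv, Complex.norm_real, Real.norm_eq_abs, abs_of_pos hz]
    have hb : ((n : ℝ) + 1) / 4 ≤ ‖s - 1 / 2‖ * ‖(ρ : ℂ) + 1 - s‖ := by
      refine le_trans ?_ (mul_le_mul b1 b2 hpos.le (norm_nonneg _))
      nlinarith
    calc _ ≤ ‖besselLine ρ z σ 0 t‖ * ((4 / z) ^ n / (n.factorial : ℝ)) / (((n : ℝ) + 1) / 4) * z⁻¹ := by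
          gcongr
      _ = _ := by
          rw [Nat.factorial_succ, pow_succ]
          push_cast
          field_simp

theorem half_add_line_ne_zero {σ : ℝ} (h0 : -(1 / 2) < σ) (h1 : σ < 0) (n : ℕ) (t : ℝ) (j : ℕ) :
    1 / 2 + (((σ - n : ℝ) : ℂ) + t * Complex.I) + (j : ℂ) ≠ 0 := by
  intro h
  have := congrArg Complex.re h
  simp at this
  have h2 : (j : ℝ) < n := by linarith
  have h3 : (n : ℝ) < j + 1 := by linarith
  have h2' : j < n := by exact_mod_cast h2
  have h3' : n < j + 1 := by exact_mod_cast h3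
  omega

theorem integrable_besselLine {ρ z σ : ℝ} (hz : 0 < z) (h0 : -(1 / 2) < σ) (h1 : σ < 0)
    (hρ : -(1 / 2) < ρ) (h2 : besselExponent ρ 0 σ < -1) (n : ℕ) : Integrable (besselLine ρ z σ n) := by
  have hi : Integrable (besselLine ρ z σ 0) := by
    have := integrable_besselKernel_mul_cpow_line ρ 0 h0 h2 hz
    refine this.congr (Eventually.of_forall fun t => ?_)
    simp [besselLine, meijerPath]
  refine (hi.norm.mul_const ((4 / z) ^ n / (n.factorial : ℝ))).mono' ?_
    (Eventually.of_forall fun t => norm_besselLine_le hz h1 hρ n t)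
  have hc : Continuous fun t : ℝ => besselResidueNumerator ρ z n (((σ - n : ℝ) : ℂ) + t * Complex.I) := by
    refine (differentiableOn_besselResidueNumerator ρ hz n).continuousOn.comp_continuous (by fun_prop) fun t => ?_
    exact ⟨by simp; linarith, by simp; linarith⟩
  have hc2 : Continuous (besselLine ρ z σ n) := by
    refine (hc.div (g := fun t : ℝ => ((σ - n : ℝ) : ℂ) + t * Complex.I - ((-(1 / 2) - n : ℝ) : ℂ))
      (by fun_prop) fun t h => ?_).congr fun t => ?_
    · have := congrArg Complex.re h
      simp at this
      linarith
    · exact besselResidueNumerator_div ρ z n (half_add_line_ne_zero h0 h1 n t)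
  exact hc2.aestronglyMeasurable

/-- Exactly one pole, -1/2-n, lies between the abscissae σ-n-1 and σ-n, because -1/2 < σ < 0. -/
theorem integral_besselLine_sub_succ {ρ z σ : ℝ} (hz : 0 < z) (h0 : -(1 / 2) < σ) (h1 : σ < 0)
    (hρ : -(1 / 2) < ρ) (h2 : besselExponent ρ 0 σ < -1) (n : ℕ) :
    (∫ t, besselLine ρ z σ n t) - ∫ t, besselLine ρ z σ (n + 1) t =
      2 * Real.pi * (((-1) ^ n / ((n.factorial : ℝ) * Real.Gamma (n + (ρ + 1 / 2) + 1)) *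
        z ^ (-(1 / 2) - n : ℝ) : ℝ) : ℂ) := by
  obtain ⟨C, hC0, hC⟩ := exists_norm_besselKernel_bounds ρ 0 ((n : ℝ) + 2)
  have hn0 : (0 : ℝ) ≤ n := Nat.cast_nonneg n
  have e1 : ∀ t : ℝ, besselResidueNumerator ρ z n (((σ - n : ℝ) : ℂ) + t * Complex.I) /
      (((σ - n : ℝ) : ℂ) + t * Complex.I - ((-(1 / 2) - n : ℝ) : ℂ)) = besselLine ρ z σ n t :=
    fun t => besselResidueNumerator_div ρ z n (half_add_line_ne_zero h0 h1 n t)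
  have e2 : ∀ t : ℝ, besselResidueNumerator ρ z n (((σ - (n + 1 : ℕ) : ℝ) : ℂ) + t * Complex.I) /
      (((σ - (n + 1 : ℕ) : ℝ) : ℂ) + t * Complex.I - ((-(1 / 2) - n : ℝ) : ℂ)) = besselLine ρ z σ (n + 1) t :=
    fun t => besselResidueNumerator_div ρ z n (half_add_line_ne_zero h0 h1 (n + 1) t)
  have hl : Tendsto (fun t : ℝ => C * |t|⁻¹ * (z ^ (σ - n) + z ^ (σ - (n + 1 : ℕ)))) atTop (𝓝 0) := by
    have : Tendsto (fun t : ℝ => |t|⁻¹) atTop (𝓝 0) := tendsto_inv_atTop_zero.comp tendsto_abs_atTop_atTop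
    simpa using (this.const_mul C).mul_const (z ^ (σ - n) + z ^ (σ - (n + 1 : ℕ)))
  have := integral_line_sub_integral_line_eq (p := -(1 / 2) - n) (a := -(3 / 2) - (n : ℝ))
    (b := 1 / 2 - (n : ℝ)) (σ₁ := σ - n) (σ₂ := σ - (n + 1 : ℕ))
    (h := fun t => C * |t|⁻¹ * (z ^ (σ - n) + z ^ (σ - (n + 1 : ℕ))))
    (by push_cast; linarith) (by push_cast; linarith) (by linarith) (by linarith)
    (differentiableOn_besselResidueNumerator ρ hz n)
    ((integrable_besselLine hz h0 h1 hρ h2 n).congr (Eventually.of_forall fun t => (e1 t).symm))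
    ((integrable_besselLine hz h0 h1 hρ h2 (n + 1)).congr (Eventually.of_forall fun t => (e2 t).symm))
    ?_ hl (by simpa using hl)
  · simp only [e1, e2, besselResidueNumerator_apply_pole ρ hz n] at this
    exact this
  · intro t ht τ hτ
    have ht0 : t ≠ 0 := fun h => by simp [h] at ht; linarith
    have hτ1 := hτ.1
    push_cast at hτ1
    rw [besselResidueNumerator_div ρ z n, norm_mul]
    · refine mul_le_mul ?_ ?_ (norm_nonneg _) (by positivity)
      · refine (hC τ t (abs_le.2 ⟨by linarith, by linarith [hτ.2]⟩) ht).1.trans ?_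
        refine mul_le_mul_of_nonneg_left ?_ hC0.le
        rw [← Real.rpow_neg_one]
        refine Real.rpow_le_rpow_of_exponent_le ht ?_
        rw [besselExponent] at h2 ⊢
        norm_num at h2 ⊢
        linarith [hτ.2]
      · rw [Complex.norm_cpow_eq_rpow_re_of_pos hz]
        simp only [Complex.add_re, Complex.ofReal_re, Complex.mul_re, Complex.I_re, mul_zero, Complex.ofReal_im,
          Complex.I_im, mul_one, sub_self, add_zero]
        refine rpow_le_add_of_mem_uIcc hz ?_
        rw [Set.uIcc_comm]
        exact Set.Icc_subset_uIcc hτ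
    · intro j h
      exact ht0 (by simpa using congrArg Complex.im h)

theorem bessel_residue_eq_bessel_term {ρ x : ℝ} (hx : 0 < x) (k : ℕ) :
    (2 : ℝ) ^ (-ρ + 1 / 2) * x ^ (ρ - 1 / 2) * (4 / x ^ 2) ^ (-(1 / 2) - k : ℝ) =
      (x / 2) ^ (2 * (k : ℝ) + (ρ + 1 / 2)) := by
  have e1 : (2 : ℝ) ^ (-ρ + 1 / 2) = (1 / 2) ^ (ρ - 1 / 2) := by
    rw [one_div (2 : ℝ), Real.inv_rpow zero_le_two, ← Real.rpow_neg zero_le_two]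
    ring_nf
  have e2 : (4 / x ^ 2) ^ (-(1 / 2) - k : ℝ) = (x / 2) ^ (2 * (k : ℝ) + 1) := by
    have : 4 / x ^ 2 = ((x / 2) ^ (2 : ℝ))⁻¹ := by
      rw [Real.rpow_two]
      field_simp
      norm_num
    rw [this, Real.inv_rpow (by positivity), ← Real.rpow_neg (by positivity), ← Real.rpow_mul (by positivity)]
    congr 1
    ring
  rw [e1, ← Real.mul_rpow (by norm_num) hx.le, e2, one_div_mul_eq_div, ← Real.rpow_add (by positivity)]
  congr 1
  ring

theorem hasSum_bessel_residues {ρ z σ : ℝ} (hz : 0 < z) (h0 : -(1 / 2) < σ) (h1 : σ < 0)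
    (hρ : -(1 / 2) < ρ) (h2 : besselExponent ρ 0 σ < -1) :
    HasSum (fun n : ℕ => 2 * (Real.pi : ℂ) * (((-1) ^ n / ((n.factorial : ℝ) *
      Real.Gamma (n + (ρ + 1 / 2) + 1)) * z ^ (-(1 / 2) - n : ℝ) : ℝ) : ℂ))
      (∫ t, besselLine ρ z σ 0 t) := by
  have hJ : Summable fun n => ∫ t, besselLine ρ z σ n t := by
    refine Summable.of_norm_bounded ((Real.summable_pow_div_factorial (4 / z)).mul_left
      (∫ t, ‖besselLine ρ z σ 0 t‖)) fun n => ?_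
    rw [← integral_mul_const]
    exact norm_integral_le_of_norm_le ((integrable_besselLine hz h0 h1 hρ h2 0).norm.mul_const _)
      (Eventually.of_forall fun t => norm_besselLine_le hz h1 hρ n t)
  -- Subtracting the shifted series telescopes: the successive differences are the residues and they
  -- sum to the integral on the first line.
  have h3 := hJ.hasSum.sub ((hasSum_nat_add_iff' 1).2 hJ.hasSum)
  simp only [Finset.sum_range_one, sub_sub_cancel, integral_besselLine_sub_succ hz h0 h1 hρ h2] at h3
  exact h3

theorem besselJ_eq_integral_besselKernel {ρ x σ : ℝ} (hx : 0 < x) (h0 : -(1 / 2) < σ) (h1 : σ < 0)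
    (hρ : -(1 / 2) < ρ) (h2 : besselExponent ρ 0 σ < -1) :
    ((besselJ (ρ + 1 / 2) x : ℝ) : ℂ) = (((2 : ℝ) ^ (-ρ + 1 / 2) * x ^ (ρ - 1 / 2) : ℝ) : ℂ) *
      (1 / (2 * (Real.pi : ℂ)) * ∫ t : ℝ, besselKernel ρ 0 (meijerPath (fun _ => σ) t) *
        (((4 / x ^ 2 : ℝ)) : ℂ) ^ meijerPath (fun _ => σ) t) := by
  have hz : 0 < 4 / x ^ 2 := by positivity
  have hpi : (Real.pi : ℂ) ≠ 0 := by exact_mod_cast Real.pi_ne_zero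
  have hsum := (hasSum_bessel_residues hz h0 h1 hρ h2).mul_left
    ((((2 : ℝ) ^ (-ρ + 1 / 2) * x ^ (ρ - 1 / 2) : ℝ) : ℂ) * (1 / (2 * (Real.pi : ℂ))))
  have hterm : ∀ (A B C : ℝ), (A : ℂ) * (1 / (2 * (Real.pi : ℂ))) *
      (2 * (Real.pi : ℂ) * ((B * C : ℝ) : ℂ)) = ((B * (A * C) : ℝ) : ℂ) := by
    intro A B C
    push_cast
    field_simp
  simp only [hterm, bessel_residue_eq_bessel_term hx] at hsum
  have hline : (∫ t, besselLine ρ (4 / x ^ 2) σ 0 t) = ∫ t : ℝ, besselKernel ρ 0 (meijerPath (fun _ => σ) t) *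
        (((4 / x ^ 2 : ℝ)) : ℂ) ^ meijerPath (fun _ => σ) t := by
    simp only [besselLine, meijerPath, Nat.cast_zero, sub_zero]
  rw [besselJ, Complex.ofReal_tsum, hsum.tsum_eq, mul_assoc, hline]

/-! ### The tail of the cosine integral as a function of s. -/

/-- The improper integral `∫_1^∞ u^(2s) cos u du` for `re s < 0`, after one integration by parts. -/
noncomputable def cosTail (s : ℂ) : ℂ :=
  -((Real.sin 1 : ℝ) : ℂ) - 2 * s * ∫ u in Set.Ioi (1 : ℝ), (u : ℂ) ^ (2 * s - 1) * ((Real.sin u : ℝ) : ℂ)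

theorem integral_one_cpow_mul_cos (s : ℂ) {b : ℝ} (hb : 1 ≤ b) :
    ∫ u in (1 : ℝ)..b, (u : ℂ) ^ (2 * s) * ((Real.cos u : ℝ) : ℂ) =
      (b : ℂ) ^ (2 * s) * ((Real.sin b : ℝ) : ℂ) - ((Real.sin 1 : ℝ) : ℂ) -
        2 * s * ∫ u in (1 : ℝ)..b, (u : ℂ) ^ (2 * s - 1) * ((Real.sin u : ℝ) : ℂ) := by
  have hpos : ∀ u ∈ Set.uIcc 1 b, (0 : ℝ) < u := by
    intro u hu
    rw [Set.uIcc_of_le hb] at hu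
    linarith [hu.1]
  have hslit : ∀ u ∈ Set.uIcc 1 b, (u : ℂ) ∈ Complex.slitPlane := fun u hu =>
    Complex.ofReal_mem_slitPlane.2 (hpos u hu)
  have hd : ∀ u ∈ Set.uIcc 1 b, HasDerivAt (fun u : ℝ => (u : ℂ) ^ (2 * s))
      (2 * s * (u : ℂ) ^ (2 * s - 1)) u := by
    intro u hu
    have := ((hasDerivAt_id (u : ℂ)).cpow_const (c := 2 * s) (hslit u hu)).comp_ofReal
    simpa using this
  have hcd : ContinuousOn (fun u : ℝ => (u : ℂ) ^ (2 * s - 1)) (Set.uIcc 1 b) := by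
    intro u hu
    exact (Complex.continuous_ofReal.continuousAt.cpow continuousAt_const (hslit u hu)).continuousWithinAt
  have hs : ∀ u ∈ Set.uIcc 1 b, HasDerivAt (fun u : ℝ => ((Real.sin u : ℝ) : ℂ)) ((Real.cos u : ℝ) : ℂ) u :=
    fun u _ => (Real.hasDerivAt_sin u).ofReal_comp
  rw [intervalIntegral.integral_mul_deriv_eq_deriv_mul hd hs
    ((hcd.const_smul (2 * s)).intervalIntegrable)
    (Continuous.intervalIntegrable (by fun_prop) _ _)]
  simp only [Complex.ofReal_one, Complex.one_cpow, one_mul, mul_assoc]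
  rw [intervalIntegral.integral_const_mul, intervalIntegral.integral_const_mul]

theorem norm_cpow_mul_sin_le {s : ℂ} {u : ℝ} (hu : 0 < u) :
    ‖(u : ℂ) ^ (2 * s - 1) * ((Real.sin u : ℝ) : ℂ)‖ ≤ u ^ (2 * s.re - 1) := by
  rw [norm_mul, Complex.norm_cpow_eq_rpow_re_of_pos hu, Complex.norm_real]
  have : (2 * s - 1).re = 2 * s.re - 1 := by simp
  rw [this]
  exact mul_le_of_le_one_right (by positivity) (Real.abs_sin_le_one u)

theorem integrableOn_cpow_mul_sin {s : ℂ} (hs : s.re < 0) :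
    IntegrableOn (fun u : ℝ => (u : ℂ) ^ (2 * s - 1) * ((Real.sin u : ℝ) : ℂ)) (Set.Ioi 1) := by
  refine (integrableOn_Ioi_rpow_of_lt (a := 2 * s.re - 1) (by linarith) one_pos).mono'
    (Measurable.aestronglyMeasurable (by fun_prop)) ?_
  exact (ae_restrict_iff' measurableSet_Ioi).2 (Eventually.of_forall fun u hu =>
    norm_cpow_mul_sin_le (zero_lt_one.trans hu))

theorem tendsto_integral_one_cpow_mul_cos {s : ℂ} (hs : s.re < 0) :
    Tendsto (fun b : ℝ => ∫ u in (1 : ℝ)..b, (u : ℂ) ^ (2 * s) * ((Real.cos u : ℝ) : ℂ)) atTop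
      (𝓝 (cosTail s)) := by
  have h1 : Tendsto (fun b : ℝ => (b : ℂ) ^ (2 * s) * ((Real.sin b : ℝ) : ℂ)) atTop (𝓝 0) := by
    have h0 : Tendsto (fun b : ℝ => b ^ (2 * s.re)) atTop (𝓝 0) := by
      have := tendsto_rpow_neg_atTop (y := -(2 * s.re)) (by linarith)
      simpa using this
    refine squeeze_zero_norm' ?_ h0
    filter_upwards [eventually_gt_atTop 0] with b hb
    rw [norm_mul, Complex.norm_cpow_eq_rpow_re_of_pos hb, Complex.norm_real]
    have : (2 * s).re = 2 * s.re := by simp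
    rw [this]
    exact mul_le_of_le_one_right (by positivity) (Real.abs_sin_le_one b)
  have h2 := intervalIntegral_tendsto_integral_Ioi 1 (integrableOn_cpow_mul_sin hs) tendsto_id
  have h3 := (h1.sub_const ((Real.sin 1 : ℝ) : ℂ)).sub (h2.const_mul (2 * s))
  rw [zero_sub] at h3
  refine h3.congr' ?_
  filter_upwards [eventually_ge_atTop 1] with b hb
  exact (integral_one_cpow_mul_cos s hb).symm

/-- The two boundary sines contribute at most 1 each, and ∫_1^∞ u^(2 Re s - 1) du = -1/(2 Re s) ≤ 2.
The bound is uniform in `b`, at the price of one factor |s|. -/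
theorem norm_integral_one_cpow_mul_cos_le {s : ℂ} (hs : s.re ≤ -(1 / 4)) {b : ℝ} (hb : 1 ≤ b) :
    ‖∫ u in (1 : ℝ)..b, (u : ℂ) ^ (2 * s) * ((Real.cos u : ℝ) : ℂ)‖ ≤ 2 + 4 * ‖s‖ := by
  have hs0 : s.re < 0 := by linarith
  rw [integral_one_cpow_mul_cos s hb]
  have hb0 : 0 < b := by linarith
  have h1 : ‖(b : ℂ) ^ (2 * s) * ((Real.sin b : ℝ) : ℂ)‖ ≤ 1 := by
    rw [norm_mul, Complex.norm_cpow_eq_rpow_re_of_pos hb0, Complex.norm_real]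
    refine mul_le_one₀ ?_ (norm_nonneg _) (Real.abs_sin_le_one b)
    exact Real.rpow_le_one_of_one_le_of_nonpos hb (by simp; linarith)
  have h2 : ‖((Real.sin 1 : ℝ) : ℂ)‖ ≤ 1 := by
    rw [Complex.norm_real]
    exact Real.abs_sin_le_one 1
  have h3 : ‖∫ u in (1 : ℝ)..b, (u : ℂ) ^ (2 * s - 1) * ((Real.sin u : ℝ) : ℂ)‖ ≤ 2 := by
    have hi := integrableOn_Ioi_rpow_of_lt (a := 2 * s.re - 1) (by linarith) one_pos
    rw [intervalIntegral.integral_of_le hb]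
    calc _ ≤ ∫ u in Set.Ioc 1 b, u ^ (2 * s.re - 1) := by
          refine norm_integral_le_of_norm_le (hi.mono_set Set.Ioc_subset_Ioi_self) ?_
          exact (ae_restrict_iff' measurableSet_Ioc).2 (Eventually.of_forall fun u hu =>
            norm_cpow_mul_sin_le (zero_lt_one.trans hu.1))
      _ ≤ ∫ u in Set.Ioi 1, u ^ (2 * s.re - 1) := by
          refine setIntegral_mono_set hi ?_ (Eventually.of_forall fun x hx => hx.1)
          refine (ae_restrict_iff' measurableSet_Ioi).2 (Eventually.of_forall fun u hu => ?_)
          have : (0 : ℝ) < u := zero_lt_one.trans hu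
          simp only [Pi.zero_apply]
          positivity
      _ ≤ 2 := by
          rw [integral_Ioi_rpow_of_lt (by linarith) one_pos, Real.one_rpow, neg_div, ← div_neg,
            div_le_iff₀ (by linarith)]
          linarith
  have h4 : ‖2 * s * ∫ u in (1 : ℝ)..b, (u : ℂ) ^ (2 * s - 1) * ((Real.sin u : ℝ) : ℂ)‖ ≤ 2 * ‖s‖ * 2 := by
    rw [norm_mul, norm_mul, Complex.norm_ofNat]
    gcongr
  refine (norm_sub_le _ _).trans ?_
  have := norm_sub_le ((b : ℂ) ^ (2 * s) * ((Real.sin b : ℝ) : ℂ)) ((Real.sin 1 : ℝ) : ℂ)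
  linarith

theorem norm_cosTail_le {s : ℂ} (hs : s.re ≤ -(1 / 4)) : ‖cosTail s‖ ≤ 2 + 4 * ‖s‖ := by
  refine le_of_tendsto (tendsto_integral_one_cpow_mul_cos (by linarith)).norm ?_
  filter_upwards [eventually_ge_atTop 1] with b hb
  exact norm_integral_one_cpow_mul_cos_le hs hb

/-- The integral is the Mellin transform of the sine cut off below 1, at 2s. The cutoff makes it
vanish near 0, so only behaviour at infinity restricts `s`. -/
theorem differentiableOn_cosTail : DifferentiableOn ℂ cosTail {s | s.re < 0} := by
  intro s hs
  have hs0 : s.re < 0 := hs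
  apply DifferentiableAt.differentiableWithinAt
  set f : ℝ → ℂ := (Set.Ioi (1 : ℝ)).indicator fun u => ((Real.sin u : ℝ) : ℂ) with hf
  have hm : DifferentiableAt ℂ (mellin f) (2 * s) := by
    refine mellin_differentiableAt_of_isBigO_rpow (a := 0) (b := 2 * s.re - 1) ?_ ?_ (by simp; linarith)
      ?_ (by simp)
    · have hc : Continuous fun u : ℝ => ((Real.sin u : ℝ) : ℂ) := by fun_prop
      exact (hc.locallyIntegrable.indicator measurableSet_Ioi).locallyIntegrableOn _
    · refine Asymptotics.IsBigO.of_bound 1 (Eventually.of_forall fun u => ?_)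
      simp only [neg_zero, Real.rpow_zero, norm_one, mul_one, hf]
      refine (norm_indicator_le_norm_self _ u).trans ?_
      rw [Complex.norm_real]
      exact Real.abs_sin_le_one u
    · refine Asymptotics.IsBigO.of_bound 1 ?_
      filter_upwards [nhdsWithin_le_nhds (Iio_mem_nhds (zero_lt_one (α := ℝ)))] with u hu
      have : u ∉ Set.Ioi (1 : ℝ) := by simpa using hu.le
      rw [hf, Set.indicator_of_notMem this]
      simp
  have e : ∀ w : ℂ, mellin f (2 * w) = ∫ u in Set.Ioi (1 : ℝ), (u : ℂ) ^ (2 * w - 1) * ((Real.sin u : ℝ) : ℂ) := by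
    intro w
    have h1 : ∀ u : ℝ, (u : ℂ) ^ (2 * w - 1) • f u = (Set.Ioi (1 : ℝ)).indicator
        (fun u : ℝ => (u : ℂ) ^ (2 * w - 1) * ((Real.sin u : ℝ) : ℂ)) u := by
      intro u
      by_cases hu : u ∈ Set.Ioi (1 : ℝ) <;> simp [hf, hu]
    simp only [mellin, h1]
    rw [setIntegral_indicator measurableSet_Ioi, Set.Ioi_inter_Ioi, max_eq_right zero_le_one]
  have hd : DifferentiableAt ℂ (fun w : ℂ => mellin f (2 * w)) s :=
    hm.comp s (by fun_prop)
  have heq : cosTail = fun w : ℂ => -((Real.sin 1 : ℝ) : ℂ) - 2 * w * mellin f (2 * w) := by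
    ext w
    rw [cosTail, e]
  rw [heq]
  fun_prop

theorem intervalIntegrable_cpow_mul_cos {s : ℂ} (h : -(1 / 2) < s.re) (a b : ℝ) :
    IntervalIntegrable (fun u : ℝ => (u : ℂ) ^ (2 * s) * ((Real.cos u : ℝ) : ℂ)) volume a b :=
  (intervalIntegral.intervalIntegrable_cpow' (by simp; linarith)).mul_continuousOn (by fun_prop)

/-- Head and tail add up to the full Mellin transform only in this strip; the tail alone remains
holomorphic on Re s < 0, which permits the bending of the contour. -/
theorem integral_zero_one_cpow_mul_cos_add_cosTail {s : ℂ} (h1 : -(1 / 2) < s.re) (h2 : s.re < 0) :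
    (∫ u in (0 : ℝ)..1, (u : ℂ) ^ (2 * s) * ((Real.cos u : ℝ) : ℂ)) + cosTail s =
      (√Real.pi : ℂ) * (4 : ℂ) ^ s * Complex.Gamma (1 / 2 + s) / Complex.Gamma (-s) := by
  refine tendsto_nhds_unique ?_ (tendsto_integral_cpow_mul_cos h1 h2)
  refine ((tendsto_integral_one_cpow_mul_cos h2).const_add _).congr fun b => ?_
  exact intervalIntegral.integral_add_adjacent_intervals (intervalIntegrable_cpow_mul_cos h1 _ _)
    (intervalIntegrable_cpow_mul_cos h1 _ _)

theorem norm_integral_zero_one_cpow_mul_cos_le {s : ℂ} (h : -(1 / 2) < s.re) :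
    ‖∫ u in (0 : ℝ)..1, (u : ℂ) ^ (2 * s) * ((Real.cos u : ℝ) : ℂ)‖ ≤ 1 / (2 * s.re + 1) := by
  have := intervalIntegral.norm_integral_le_of_norm_le (f := fun u : ℝ => (u : ℂ) ^ (2 * s) * ((Real.cos u : ℝ) : ℂ))
    (g := fun u => u ^ (2 * s.re)) (μ := volume) zero_le_one
    (Eventually.of_forall fun u hu => ?_)
    (intervalIntegral.intervalIntegrable_rpow' (by linarith))
  · rw [integral_rpow (Or.inl (by linarith)), Real.zero_rpow (by linarith), Real.one_rpow, sub_zero] at this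
    exact this
  · rw [norm_mul, Complex.norm_cpow_eq_rpow_re_of_pos hu.1, Complex.norm_real]
    have e : (2 * s).re = 2 * s.re := by simp
    have := hu.1
    rw [e]
    exact mul_le_of_le_one_right (by positivity) (Real.abs_cos_le_one u)

/-! ### Interchanging the improper integral with the contour integral. -/

theorem measurable_meijerPath {γ : ℝ → ℝ} (h : Continuous γ) : Measurable (meijerPath γ) :=
  (continuous_meijerPath h).measurable

/-- Fubini for a contour integral of powers against the cosine. -/
theorem fubini_cpow_mul_cos {γ : ℝ → ℝ} (hγ : Continuous γ) {k : ℝ → ℂ} (hk : Integrable k) {a b : ℝ}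
    (ha : 0 ≤ a) (hab : a ≤ b) {g : ℝ → ℝ} (hg : IntegrableOn g (Set.Ioc a b))
    (hb : ∀ u ∈ Set.Ioc a b, ∀ t, u ^ (2 * γ t) ≤ g u) :
    IntegrableOn (fun u : ℝ => ∫ t, k t * ((u : ℂ) ^ (2 * meijerPath γ t) * ((Real.cos u : ℝ) : ℂ)))
        (Set.Ioc a b) ∧
      Integrable (fun t => k t * ∫ u in a..b, (u : ℂ) ^ (2 * meijerPath γ t) * ((Real.cos u : ℝ) : ℂ)) ∧
      ∫ u in a..b, ∫ t, k t * ((u : ℂ) ^ (2 * meijerPath γ t) * ((Real.cos u : ℝ) : ℂ)) =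
        ∫ t, k t * ∫ u in a..b, (u : ℂ) ^ (2 * meijerPath γ t) * ((Real.cos u : ℝ) : ℂ) := by
  set F : ℝ → ℝ → ℂ := fun u t => k t * ((u : ℂ) ^ (2 * meijerPath γ t) * ((Real.cos u : ℝ) : ℂ)) with hF
  have hmp := measurable_meijerPath hγ
  have hprod : Integrable (Function.uncurry F) ((volume.restrict (Set.Ioc a b)).prod volume) := by
    refine (Integrable.mul_prod hg hk.norm).mono' ?_ ?_
    · refine AEStronglyMeasurable.mul hk.aestronglyMeasurable.comp_snd
        (Measurable.aestronglyMeasurable ?_)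
      fun_prop
    · have : ∀ᵐ p : ℝ × ℝ ∂((volume.restrict (Set.Ioc a b)).prod volume), p.1 ∈ Set.Ioc a b :=
        Measure.quasiMeasurePreserving_fst.ae (ae_restrict_mem measurableSet_Ioc)
      filter_upwards [this] with p hp
      have hp0 : 0 < p.1 := ha.trans_lt hp.1
      simp only [Function.uncurry, hF]
      rw [norm_mul, norm_mul, Complex.norm_cpow_eq_rpow_re_of_pos hp0, Complex.norm_real, mul_comm]
      refine mul_le_mul_of_nonneg_right ?_ (norm_nonneg _)
      have e : (2 * meijerPath γ p.2).re = 2 * γ p.2 := by simp [meijerPath]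
      rw [e]
      refine (mul_le_of_le_one_right (by positivity) (Real.abs_cos_le_one _)).trans (hb p.1 hp p.2)
  have e : ∀ t, k t * ∫ u in a..b, (u : ℂ) ^ (2 * meijerPath γ t) * ((Real.cos u : ℝ) : ℂ) =
      ∫ u in Set.Ioc a b, F u t := by
    intro t
    rw [intervalIntegral.integral_of_le hab, ← integral_const_mul]
  refine ⟨hprod.integral_prod_left, ?_, ?_⟩
  · simp only [e]
    exact hprod.integral_prod_right
  · simp only [e]
    rw [intervalIntegral.integral_of_le hab]
    exact integral_integral_swap hprod

/-- A path which passes to the right of `-1/2` and tends to `-2` at both ends. -/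
noncomputable def bentPath (t : ℝ) : ℝ := -2 + 7 / 4 * (1 + t ^ 2)⁻¹

theorem contDiff_bentPath : ContDiff ℝ 1 bentPath := by
  unfold bentPath
  refine contDiff_const.add (contDiff_const.mul (ContDiff.inv (by fun_prop) fun t => ?_))
  positivity

/-- The maximum -1/4, attained at t = 0, keeps the crossing to the right of -1/2 and the whole path
inside the range of the uniform cosine bounds. -/
theorem bentPath_mem_Icc (t : ℝ) : bentPath t ∈ Set.Icc (-2) (-(1 / 4)) := by
  have h1 : (1 + t ^ 2)⁻¹ ≤ 1 := inv_le_one_of_one_le₀ (by nlinarith [sq_nonneg t])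
  have h2 : 0 ≤ (1 + t ^ 2)⁻¹ := by positivity
  constructor <;> (unfold bentPath; linarith)

theorem bentPath_le_neg_one {t : ℝ} (ht : 1 ≤ |t|) : bentPath t ≤ -1 := by
  have ht2 : 1 ≤ t ^ 2 := by rw [← sq_abs]; nlinarith
  have h1 : (1 + t ^ 2)⁻¹ ≤ 2⁻¹ := by gcongr; linarith
  unfold bentPath
  linarith

theorem bentPath_le_of_two_le {t : ℝ} (ht : 2 ≤ |t|) : bentPath t ≤ -(3 / 2) := by
  have ht2 : 4 ≤ t ^ 2 := by rw [← sq_abs]; nlinarith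
  have h1 : (1 + t ^ 2)⁻¹ ≤ 5⁻¹ := by gcongr; linarith
  unfold bentPath
  linarith

theorem norm_deriv_bentPath_add_I_le (t : ℝ) : ‖((deriv bentPath t : ℝ) : ℂ) + Complex.I‖ ≤ 5 := by
  have hd : HasDerivAt bentPath (7 / 4 * (-(2 * t) / (1 + t ^ 2) ^ 2)) t := by
    have h0 : 1 + t ^ 2 ≠ 0 := by positivity
    have := ((((hasDerivAt_id t).pow 2).const_add 1).inv h0).const_mul (7 / 4 : ℝ)
    refine (this.const_add (-2)).congr_deriv ?_
    simp
  have hb : |deriv bentPath t| ≤ 4 := by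
    have e : |-(2 * t) / (1 + t ^ 2) ^ 2| = |2 * t| / (1 + t ^ 2) ^ 2 := by
      rw [abs_div, abs_neg, abs_of_pos (by positivity : (0 : ℝ) < (1 + t ^ 2) ^ 2)]
    rw [hd.deriv, abs_mul, e]
    have : |2 * t| / (1 + t ^ 2) ^ 2 ≤ 1 := by
      rw [div_le_one (by positivity), abs_mul, abs_two]
      nlinarith [sq_abs t, sq_nonneg (|t| - 1), sq_nonneg (t ^ 2)]
    rw [abs_of_pos (by norm_num : (0 : ℝ) < 7 / 4)]
    linarith
  refine (norm_add_le _ _).trans ?_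
  rw [Complex.norm_real, Complex.norm_I, Real.norm_eq_abs]
  linarith

theorem norm_meijerPath_le {γ : ℝ → ℝ} {M t : ℝ} (h : |γ t| ≤ M) : ‖meijerPath γ t‖ ≤ M + |t| := by
  refine (norm_add_le _ _).trans ?_
  rw [norm_mul, Complex.norm_real, Complex.norm_real, Complex.norm_I, mul_one]
  exact add_le_add h le_rfl

theorem continuous_besselKernel_mul_cpow_mul_velocity (ρ : ℝ) (r : ℕ) {z : ℝ} (hz : 0 < z) :
    Continuous fun t => besselKernel ρ r (meijerPath bentPath t) * (z : ℂ) ^ meijerPath bentPath t *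
      (((deriv bentPath t : ℝ) : ℂ) + Complex.I) := by
  have hc := contDiff_bentPath.continuous
  have h0 : -(1 / 2) < bentPath 0 := by norm_num [bentPath]
  have hd : Continuous (deriv bentPath) := contDiff_bentPath.continuous_deriv le_rfl
  exact ((continuous_besselKernel_path ρ r hc h0).mul (continuous_cpow_meijerPath hz hc)).mul (by fun_prop)

/-- This is what the bending buys: the kernel absorbs the factor 2 + 4|s| from the truncated cosine
integrals, giving the majorant for the limit b → ∞. -/
theorem integrable_besselKernel_bentPath {ρ : ℝ} (hρ : -(1 / 2) < ρ) (r : ℕ) {z : ℝ} (hz : 0 < z) :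
    Integrable fun t => (2 + 4 * ‖meijerPath bentPath t‖) *
      ‖besselKernel ρ r (meijerPath bentPath t) * (z : ℂ) ^ meijerPath bentPath t *
      (((deriv bentPath t : ℝ) : ℂ) + Complex.I)‖ := by
  obtain ⟨C, hC0, hC⟩ := exists_norm_besselKernel_bounds ρ r 2
  have habs : ∀ t, |bentPath t| ≤ 2 := fun t =>
    abs_le.2 ⟨(bentPath_mem_Icc t).1, (bentPath_mem_Icc t).2.trans (by norm_num)⟩
  -- For |t| ≥ 2 the abscissa is at most -3/2, where the growth exponent is below -3, so one more
  -- power of |t| is harmless. There also 2 + 4(2+|t|) ≤ 10|t|, and 5 bounds the velocity.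
  refine integrable_of_norm_le_rpow (C := 10 * (C * (z ^ (-2 : ℝ) + z ^ (-(1 / 4) : ℝ)) * 5))
    (α := besselExponent ρ r (-(3 / 2)) + 1) (T := 2) ?_ ?_ fun t ht => ?_
  · have := continuous_besselKernel_mul_cpow_mul_velocity ρ r hz
    have := continuous_meijerPath contDiff_bentPath.continuous
    fun_prop
  · have hr : (0 : ℝ) ≤ r := Nat.cast_nonneg r
    rw [besselExponent]
    nlinarith
  · have ht1 : 1 ≤ |t| := by linarith
    have hT : 0 < |t| := by linarith
    have h1 : ‖besselKernel ρ r (meijerPath bentPath t)‖ ≤ C * |t| ^ besselExponent ρ r (-(3 / 2)) := by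
      refine (hC _ t (habs t) ht1).1.trans (mul_le_mul_of_nonneg_left ?_ hC0.le)
      refine Real.rpow_le_rpow_of_exponent_le ht1 ?_
      have hr : (0 : ℝ) ≤ r := Nat.cast_nonneg r
      have := bentPath_le_of_two_le ht
      rw [besselExponent, besselExponent]
      gcongr
    have h2 : ‖(z : ℂ) ^ meijerPath bentPath t‖ ≤ z ^ (-2 : ℝ) + z ^ (-(1 / 4) : ℝ) := by
      rw [norm_cpow_meijerPath hz]
      exact rpow_le_add_of_mem_uIcc hz (Set.Icc_subset_uIcc (bentPath_mem_Icc t))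
    have h3 := norm_deriv_bentPath_add_I_le t
    have h4 : 2 + 4 * ‖meijerPath bentPath t‖ ≤ 10 * |t| := by
      have := norm_meijerPath_le (habs t)
      linarith
    rw [Real.norm_eq_abs, abs_of_nonneg (by positivity), norm_mul, norm_mul]
    calc _ ≤ 10 * |t| * (C * |t| ^ besselExponent ρ r (-(3 / 2)) * (z ^ (-2 : ℝ) + z ^ (-(1 / 4) : ℝ)) * 5) := by
          gcongr
      _ = _ := by
          rw [Real.rpow_add_one hT.ne']
          ring

theorem integrable_besselKernel_mul_velocity {ρ : ℝ} (hρ : -(1 / 2) < ρ) (r : ℕ) {z : ℝ} (hz : 0 < z) :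
    Integrable fun t => besselKernel ρ r (meijerPath bentPath t) * (z : ℂ) ^ meijerPath bentPath t *
      (((deriv bentPath t : ℝ) : ℂ) + Complex.I) := by
  refine (integrable_besselKernel_bentPath hρ r hz).mono'
    (continuous_besselKernel_mul_cpow_mul_velocity ρ r hz).aestronglyMeasurable
    (Eventually.of_forall fun t => ?_)
  refine le_mul_of_one_le_left (norm_nonneg _) ?_
  linarith [norm_nonneg (meijerPath bentPath t)]

theorem cpow_mul_sq {z u : ℝ} (hz : 0 < z) (hu : 0 < u) (s : ℂ) :
    ((z * u ^ 2 : ℝ) : ℂ) ^ s = (z : ℂ) ^ s * (u : ℂ) ^ (2 * s) := by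
  have hzu : 0 < z * u ^ 2 := by positivity
  rw [Complex.cpow_def_of_ne_zero (by exact_mod_cast hzu.ne'), Complex.cpow_def_of_ne_zero (by exact_mod_cast hz.ne'),
    Complex.cpow_def_of_ne_zero (by exact_mod_cast hu.ne'), ← Complex.ofReal_log hzu.le,
    ← Complex.ofReal_log hz.le, ← Complex.ofReal_log hu.le, Real.log_mul hz.ne' (by positivity), Real.log_pow,
    ← Complex.exp_add]
  push_cast
  ring_nf

/-- For fixed `u` the factor u^(2s) merges with z^s into (z u²)^s, so independence of the path
applies at that argument. -/
theorem integral_line_eq_integral_bentPath {ρ : ℝ} (hρ : -(1 / 2) < ρ) (r : ℕ) {z σ : ℝ} (hz : 0 < z)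
    (h1 : -(1 / 2) < σ) (h2 : besselExponent ρ r σ < -1) {u : ℝ} (hu : 0 < u) (w : ℂ) :
    ∫ t, besselKernel ρ r (meijerPath (fun _ => σ) t) * (z : ℂ) ^ meijerPath (fun _ => σ) t * Complex.I *
        ((u : ℂ) ^ (2 * meijerPath (fun _ => σ) t) * w) =
      ∫ t, besselKernel ρ r (meijerPath bentPath t) * (z : ℂ) ^ meijerPath bentPath t *
        (((deriv bentPath t : ℝ) : ℂ) + Complex.I) * ((u : ℂ) ^ (2 * meijerPath bentPath t) * w) := by
  have hzu : 0 < z * u ^ 2 := by positivity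
  have h := integral_besselKernel_path_eq ρ r hzu contDiff_const contDiff_bentPath (γ₀ := fun _ => σ)
    ⟨|σ|, fun _ => le_rfl⟩ ⟨2, fun t => abs_le.2 ⟨(bentPath_mem_Icc t).1, (bentPath_mem_Icc t).2.trans (by norm_num)⟩⟩
    h1 (by norm_num [bentPath])
    (by simpa using (integrable_besselKernel_mul_cpow_line ρ r h1 h2 hzu).mul_const Complex.I)
    (integrable_besselKernel_mul_velocity hρ r hzu)
  simp only [deriv_const, Complex.ofReal_zero, zero_add, cpow_mul_sq hz hu] at h
  have h' := congrArg (· * w) h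
  simp only [← integral_mul_const] at h'
  refine Eq.trans (integral_congr_ae (Eventually.of_forall fun t => ?_))
    (h'.trans (integral_congr_ae (Eventually.of_forall fun t => ?_)))
  · dsimp only
    ring
  · dsimp only
    ring

/-- The cosine transform contributes exactly the factor Γ(1/2+s)/Γ(-s) that raises the index of the
kernel. -/
theorem besselKernel_mul_cosMellin (ρ : ℝ) (r : ℕ) {z : ℝ} (hz : 0 < z) (s : ℂ) :
    besselKernel ρ r s * (z : ℂ) ^ s *
      ((√Real.pi : ℂ) * (4 : ℂ) ^ s * Complex.Gamma (1 / 2 + s) / Complex.Gamma (-s)) =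
    (√Real.pi : ℂ) * (besselKernel ρ (r + 1) s * ((4 * z : ℝ) : ℂ) ^ s) := by
  have h : ((4 * z : ℝ) : ℂ) ^ s = (4 : ℂ) ^ s * (z : ℂ) ^ s := by
    have := Complex.mul_cpow_ofReal_nonneg (a := 4) (b := z) (by norm_num) hz.le s
    push_cast at this ⊢
    exact this
  rw [h, besselKernel, besselKernel]
  ring

/-- On the line, the kernel times the tail of the cosine integral is integrable. -/
theorem integrable_besselKernel_mul_cosTail_line {ρ : ℝ} (r : ℕ) {z σ : ℝ} (hz : 0 < z)
    (h1 : -(1 / 2) < σ) (h1' : σ < 0) (h2 : besselExponent ρ r σ < -1)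
    (h3 : besselExponent ρ (r + 1) σ < -1) :
    Integrable fun t => besselKernel ρ r (meijerPath (fun _ => σ) t) * (z : ℂ) ^ meijerPath (fun _ => σ) t *
      cosTail (meijerPath (fun _ => σ) t) := by
  have hre : ∀ t, (meijerPath (fun _ => σ) t).re = σ := fun t => by simp [meijerPath]
  have hi := integrable_besselKernel_mul_cpow_line ρ r h1 h2 hz
  have hi' := (integrable_besselKernel_mul_cpow_line ρ (r + 1) h1 h3 (by positivity : 0 < 4 * z)).const_mul (√Real.pi : ℂ)
  refine (hi'.norm.add (hi.norm.mul_const (1 / (2 * σ + 1)))).mono' ?_ (Eventually.of_forall fun t => ?_)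
  · refine Continuous.aestronglyMeasurable ?_
    refine ((continuous_besselKernel_path ρ r continuous_const h1).mul
      (continuous_cpow_meijerPath hz continuous_const)).mul ?_
    exact differentiableOn_cosTail.continuousOn.comp_continuous (continuous_meijerPath continuous_const)
      fun t => by simpa [hre] using h1'
  · have e : cosTail (meijerPath (fun _ => σ) t) = _ :=
      eq_sub_of_add_eq' (integral_zero_one_cpow_mul_cos_add_cosTail (s := meijerPath (fun _ => σ) t)
        (by rw [hre]; exact h1) (by rw [hre]; exact h1'))
    rw [e, mul_sub, besselKernel_mul_cosMellin ρ r hz]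
    refine (norm_sub_le _ _).trans (add_le_add le_rfl ?_)
    rw [norm_mul]
    refine mul_le_mul_of_nonneg_left ?_ (norm_nonneg _)
    have := norm_integral_zero_one_cpow_mul_cos_le (s := meijerPath (fun _ => σ) t) (by rw [hre]; exact h1)
    rwa [hre] at this

/-- The shift takes place inside Re s < 0, where the tail is holomorphic. On the horizontal segments
O(|t|^(E+1)) suffices, E being the growth exponent at σ, and this tends to 0 because E < -1. -/
theorem integral_besselKernel_mul_cosTail_bentPath {ρ : ℝ} (hρ : -(1 / 2) < ρ) (r : ℕ) {z σ : ℝ} (hz : 0 < z)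
    (h1 : -(1 / 2) < σ) (h1' : σ ≤ -(1 / 4)) (h2 : besselExponent ρ r σ < -1)
    (h3 : besselExponent ρ (r + 1) σ < -1) :
    ∫ t, besselKernel ρ r (meijerPath bentPath t) * (z : ℂ) ^ meijerPath bentPath t *
        (((deriv bentPath t : ℝ) : ℂ) + Complex.I) * cosTail (meijerPath bentPath t) =
      ∫ t, besselKernel ρ r (meijerPath (fun _ => σ) t) * (z : ℂ) ^ meijerPath (fun _ => σ) t * Complex.I *
        cosTail (meijerPath (fun _ => σ) t) := by
  obtain ⟨C, hC0, hC⟩ := exists_norm_besselKernel_bounds ρ r 2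
  have hzc : (z : ℂ) ≠ 0 := by exact_mod_cast hz.ne'
  have h00 : -(1 / 2) < bentPath 0 := by norm_num [bentPath]
  have hre : ∀ (γ : ℝ → ℝ) t, (meijerPath γ t).re = γ t := fun γ t => by simp [meijerPath]
  have hi₁ := (integrable_besselKernel_mul_cosTail_line r hz h1 (by linarith) h2 h3).mul_const Complex.I
  have hi₀ : Integrable fun t => besselKernel ρ r (meijerPath bentPath t) * (z : ℂ) ^ meijerPath bentPath t *
      cosTail (meijerPath bentPath t) * (((deriv bentPath t : ℝ) : ℂ) + Complex.I) := by
    refine (integrable_besselKernel_bentPath hρ r hz).mono' ?_ (Eventually.of_forall fun t => ?_)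
    · have hc : Continuous fun t => cosTail (meijerPath bentPath t) :=
        differentiableOn_cosTail.continuousOn.comp_continuous (continuous_meijerPath contDiff_bentPath.continuous)
          fun t => by
            change (meijerPath bentPath t).re < 0
            rw [hre]
            linarith [(bentPath_mem_Icc t).2]
      have := ((continuous_besselKernel_mul_cpow_mul_velocity ρ r hz).mul hc).aestronglyMeasurable (μ := volume)
      refine this.congr (Eventually.of_forall fun t => ?_)
      exact mul_right_comm _ _ _
    · rw [mul_right_comm, norm_mul, mul_comm]
      refine mul_le_mul_of_nonneg_right (norm_cosTail_le ?_) (norm_nonneg _)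
      rw [hre]
      exact (bentPath_mem_Icc t).2
  have hpow : Tendsto (fun t : ℝ => t ^ (besselExponent ρ r σ + 1)) atTop (𝓝 0) := by
    have := tendsto_rpow_neg_atTop (y := -(besselExponent ρ r σ + 1)) (by linarith)
    simpa using this
  have hlim : Tendsto (fun t : ℝ => C * (z ^ (-2 : ℝ) + z ^ (0 : ℝ)) * 14 * |t| ^ (besselExponent ρ r σ + 1))
      atTop (𝓝 0) := by
    simpa using (hpow.comp tendsto_abs_atTop_atTop).const_mul (C * (z ^ (-2 : ℝ) + z ^ (0 : ℝ)) * 14)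
  have key := integral_path_eq_of_horizontal_small
    (f := fun s => besselKernel ρ r s * (z : ℂ) ^ s * cosTail s) (γ₀ := bentPath) (γ₁ := fun _ => σ)
    (U := gammaSlit ∩ {s | s.re < 0}) (M := 2)
    (h := fun t => C * (z ^ (-2 : ℝ) + z ^ (0 : ℝ)) * 14 * |t| ^ (besselExponent ρ r σ + 1))
    contDiff_bentPath contDiff_const
    (isOpen_gammaSlit.inter (isOpen_lt Complex.continuous_re continuous_const)) ?_ ?_ hi₀
    (by simpa using hi₁) ?_ ?_ ?_
  · simp only [deriv_const, Complex.ofReal_zero, zero_add] at key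
    refine Eq.trans (integral_congr_ae (Eventually.of_forall fun t => ?_))
      (key.trans (integral_congr_ae (Eventually.of_forall fun t => ?_)))
    · exact mul_right_comm _ _ _
    · exact mul_right_comm _ _ _
  · refine ((((differentiableOn_besselKernel ρ r).mono Set.inter_subset_left).mul ?_).mul
      (differentiableOn_cosTail.mono Set.inter_subset_right))
    exact (differentiable_id.const_cpow (Or.inl hzc)).differentiableOn
  · intro t τ hτ
    refine ⟨mem_gammaSlit_of_between (γ₁ := fun _ => σ) h00 h1 t τ hτ, ?_⟩
    have h4 := hτ.2.trans (max_le (bentPath_mem_Icc t).2 h1')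
    change ((τ : ℂ) + t * Complex.I).re < 0
    simp
    linarith
  · intro t
    have := bentPath_mem_Icc t
    exact abs_le.2 ⟨by linarith [this.2], by linarith [this.1]⟩
  · intro t ht τ hτ
    have hT : 0 < |t| := by linarith
    have hb := bentPath_le_neg_one ht
    -- For |t| ≥ 1 the bent path lies left of -1 < σ, so the growth exponent on the segment is
    -- largest at σ.
    have hτ1 : τ ≤ σ := hτ.2.trans (max_le (by linarith) le_rfl)
    have hτ2 : -2 ≤ τ := (le_min (bentPath_mem_Icc t).1 (by linarith)).trans hτ.1
    have hτabs : |τ| ≤ 2 := abs_le.2 ⟨hτ2, by linarith⟩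
    have a1 : ‖besselKernel ρ r ((τ : ℂ) + t * Complex.I)‖ ≤ C * |t| ^ besselExponent ρ r σ := by
      refine (hC τ t hτabs ht).1.trans (mul_le_mul_of_nonneg_left ?_ hC0.le)
      refine Real.rpow_le_rpow_of_exponent_le ht ?_
      rw [besselExponent, besselExponent]
      gcongr
    have a2 : ‖(z : ℂ) ^ ((τ : ℂ) + t * Complex.I)‖ ≤ z ^ (-2 : ℝ) + z ^ (0 : ℝ) := by
      have := norm_cpow_meijerPath hz (fun _ => τ) t
      simp only [meijerPath] at this
      rw [this]
      exact rpow_le_add_of_mem_uIcc hz (Set.Icc_subset_uIcc ⟨hτ2, by linarith⟩)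
    have a3 : ‖cosTail ((τ : ℂ) + t * Complex.I)‖ ≤ 14 * |t| := by
      refine (norm_cosTail_le (by simp; linarith)).trans ?_
      have := norm_meijerPath_le (γ := fun _ => τ) (t := t) hτabs
      simp only [meijerPath] at this
      linarith
    rw [norm_mul, norm_mul]
    calc _ ≤ C * |t| ^ besselExponent ρ r σ * (z ^ (-2 : ℝ) + z ^ (0 : ℝ)) * (14 * |t|) := by gcongr
      _ = _ := by
        rw [Real.rpow_add_one hT.ne']
        ring
  · intro ε hε
    refine Eventually.frequently ?_
    filter_upwards [hlim.eventually (gt_mem_nhds hε)] with t ht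
    exact ⟨ht, by simpa using ht⟩

theorem intervalIntegrable_and_tendsto_of_head_tail {W : ℝ → ℂ} (hW : ∀ b, 0 ≤ b → IntegrableOn W (Set.Ioc 0 b))
    {L : ℂ} (hL : Tendsto (fun b : ℝ => ∫ u in (1 : ℝ)..b, W u) atTop (𝓝 L)) :
    (∀ a b : ℝ, 0 < a → a ≤ b → IntervalIntegrable W volume a b) ∧
      Tendsto (fun p : ℝ × ℝ => ∫ u in p.1..p.2, W u) (𝓝[>] (0 : ℝ) ×ˢ atTop)
        (𝓝 ((∫ u in (0 : ℝ)..1, W u) + L)) := by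
  have hI : ∀ a b : ℝ, 0 ≤ a → 0 ≤ b → IntervalIntegrable W volume a b := by
    have h0 : ∀ b : ℝ, 0 ≤ b → IntervalIntegrable W volume 0 b := fun b hb =>
      (intervalIntegrable_iff_integrableOn_Ioc_of_le hb).2 (hW b hb)
    exact fun a b ha hb => (h0 a ha).symm.trans (h0 b hb)
  refine ⟨fun a b ha hab => hI a b ha.le (ha.le.trans hab), ?_⟩
  have hhead : Tendsto (fun a : ℝ => ∫ u in a..1, W u) (𝓝[>] 0) (𝓝 (∫ u in (0 : ℝ)..1, W u)) := by
    have hint : IntegrableOn W (Set.uIcc (0 : ℝ) 1) := by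
      rw [Set.uIcc_of_le zero_le_one, integrableOn_Icc_iff_integrableOn_Ioc]
      exact hW 1 zero_le_one
    have hc := intervalIntegral.continuousOn_primitive_interval_left hint 0 Set.left_mem_uIcc
    rw [Set.uIcc_of_le zero_le_one] at hc
    exact hc.tendsto.mono_left (nhdsWithin_le_of_mem (mem_of_superset (Ioc_mem_nhdsGT zero_lt_one)
      Set.Ioc_subset_Icc_self))
  refine ((hhead.comp tendsto_fst).add (hL.comp tendsto_snd)).congr' ?_
  have hev : ∀ᶠ p : ℝ × ℝ in 𝓝[>] (0 : ℝ) ×ˢ atTop, p.1 ∈ Set.Ioi (0 : ℝ) ∧ 1 ≤ p.2 :=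
    (tendsto_fst.eventually self_mem_nhdsWithin).and (tendsto_snd.eventually (eventually_ge_atTop 1))
  filter_upwards [hev] with p hp
  exact intervalIntegral.integral_add_adjacent_intervals (hI _ _ hp.1.le zero_le_one)
    (hI _ _ zero_le_one (zero_le_one.trans hp.2))

/-- The contour is bent separately for each `u`, Fubini is applied on [1,b], b → ∞ is taken by
dominated convergence on the bent path, and the resulting tail integral is moved back to the line.
-/
theorem tendsto_integral_one_besselKernel {ρ : ℝ} (hρ : -(1 / 2) < ρ) (r : ℕ) {z σ : ℝ} (hz : 0 < z)
    (h1 : -(1 / 2) < σ) (h1' : σ ≤ -(1 / 4)) (h2 : besselExponent ρ r σ < -1)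
    (h3 : besselExponent ρ (r + 1) σ < -1) :
    Tendsto (fun b : ℝ => ∫ u in (1 : ℝ)..b, ∫ t, besselKernel ρ r (meijerPath (fun _ => σ) t) *
      (z : ℂ) ^ meijerPath (fun _ => σ) t * Complex.I *
        ((u : ℂ) ^ (2 * meijerPath (fun _ => σ) t) * ((Real.cos u : ℝ) : ℂ))) atTop
      (𝓝 (∫ t, besselKernel ρ r (meijerPath (fun _ => σ) t) * (z : ℂ) ^ meijerPath (fun _ => σ) t * Complex.I *
        cosTail (meijerPath (fun _ => σ) t))) := by
  rw [← integral_besselKernel_mul_cosTail_bentPath hρ r hz h1 h1' h2 h3]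
  have hk := integrable_besselKernel_mul_velocity hρ r hz
  have hre : ∀ t, (meijerPath bentPath t).re ≤ -(1 / 4) := fun t => by
    simpa [meijerPath] using (bentPath_mem_Icc t).2
  have hfub := fun {b : ℝ} (hb : 1 ≤ b) => fubini_cpow_mul_cos contDiff_bentPath.continuous hk zero_le_one hb
    (g := fun _ => 1) (integrableOn_const (by simp)) (fun u hu t =>
      Real.rpow_le_one_of_one_le_of_nonpos hu.1.le (by linarith [(bentPath_mem_Icc t).2]))
  have hlim : Tendsto (fun b : ℝ => ∫ t, besselKernel ρ r (meijerPath bentPath t) * (z : ℂ) ^ meijerPath bentPath t *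
      (((deriv bentPath t : ℝ) : ℂ) + Complex.I) *
      ∫ u in (1 : ℝ)..b, (u : ℂ) ^ (2 * meijerPath bentPath t) * ((Real.cos u : ℝ) : ℂ)) atTop
      (𝓝 (∫ t, besselKernel ρ r (meijerPath bentPath t) * (z : ℂ) ^ meijerPath bentPath t *
        (((deriv bentPath t : ℝ) : ℂ) + Complex.I) * cosTail (meijerPath bentPath t))) := by
    refine tendsto_integral_filter_of_dominated_convergence _ ?_ ?_ (integrable_besselKernel_bentPath hρ r hz) ?_
    · filter_upwards [eventually_ge_atTop 1] with b hb using (hfub hb).2.1.aestronglyMeasurable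
    · filter_upwards [eventually_ge_atTop 1] with b hb
      refine Eventually.of_forall fun t => ?_
      rw [norm_mul, mul_comm]
      exact mul_le_mul_of_nonneg_right (norm_integral_one_cpow_mul_cos_le (hre t) hb) (norm_nonneg _)
    · refine Eventually.of_forall fun t => Tendsto.const_mul _ ?_
      exact tendsto_integral_one_cpow_mul_cos (by linarith [hre t])
  refine hlim.congr' ?_
  filter_upwards [eventually_ge_atTop 1] with b hb
  rw [← (hfub hb).2.2]
  refine intervalIntegral.integral_congr fun u hu => ?_
  rw [Set.uIcc_of_le hb] at hu
  exact (integral_line_eq_integral_bentPath hρ r hz h1 h2 (zero_lt_one.trans_le hu.1) _).symm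

/-- The improper integral of the cosine against the Mellin–Barnes integral. -/
theorem improper_integral_cos_besselKernel {ρ : ℝ} (hρ : -(1 / 2) < ρ) (r : ℕ) {z σ : ℝ} (hz : 0 < z)
    (h1 : -(1 / 2) < σ) (h1' : σ ≤ -(1 / 4)) (h2 : besselExponent ρ r σ < -1)
    (h3 : besselExponent ρ (r + 1) σ < -1) {W : ℝ → ℂ}
    (hW : ∀ u, 0 < u → W u = ((Real.cos u : ℝ) : ℂ) * ∫ t, besselKernel ρ r (meijerPath (fun _ => σ) t) *
      ((z * u ^ 2 : ℝ) : ℂ) ^ meijerPath (fun _ => σ) t) :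
    (∀ a b : ℝ, 0 < a → a ≤ b → IntervalIntegrable W volume a b) ∧
      Tendsto (fun p : ℝ × ℝ => ∫ u in p.1..p.2, W u) (𝓝[>] (0 : ℝ) ×ˢ atTop)
        (𝓝 ((√Real.pi : ℂ) * ∫ t, besselKernel ρ (r + 1) (meijerPath (fun _ => σ) t) *
          ((4 * z : ℝ) : ℂ) ^ meijerPath (fun _ => σ) t)) := by
  have hσ : σ < 0 := by linarith
  have hre : ∀ t, (meijerPath (fun _ => σ) t).re = σ := fun t => by simp [meijerPath]
  set k : ℝ → ℂ := fun t => besselKernel ρ r (meijerPath (fun _ => σ) t) *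
      (z : ℂ) ^ meijerPath (fun _ => σ) t * Complex.I with hkdef
  have hk : Integrable k := (integrable_besselKernel_mul_cpow_line ρ r h1 h2 hz).mul_const Complex.I
  set V : ℝ → ℂ := fun u => ∫ t, k t * ((u : ℂ) ^ (2 * meijerPath (fun _ => σ) t) * ((Real.cos u : ℝ) : ℂ)) with hV
  -- Near u = 0 the straight line is the one to use: u^(2σ) is integrable there because 2σ > -1,
  -- whereas powers close to u^(-4) occur on the bent path.
  have hfub := fun {b : ℝ} (hb : 0 ≤ b) => fubini_cpow_mul_cos (γ := fun _ => σ) continuous_const hk le_rfl hb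
    ((intervalIntegrable_iff_integrableOn_Ioc_of_le hb).1
      (intervalIntegral.intervalIntegrable_rpow' (a := 0) (b := b) (r := 2 * σ) (by linarith)))
    (fun u hu t => le_rfl)
  have hWV : ∀ u, 0 < u → W u = V u * (Complex.I)⁻¹ := by
    intro u hu
    rw [hW u hu, hV, ← integral_const_mul, ← integral_mul_const]
    refine integral_congr_ae (Eventually.of_forall fun t => ?_)
    simp only [hkdef, cpow_mul_sq hz hu]
    have := Complex.I_ne_zero
    field_simp
  obtain ⟨hVi, hVt⟩ := intervalIntegrable_and_tendsto_of_head_tail (fun b hb => (hfub hb).1)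
    (tendsto_integral_one_besselKernel hρ r hz h1 h1' h2 h3)
  have hkt : Integrable fun t => k t * cosTail (meijerPath (fun _ => σ) t) := by
    refine ((integrable_besselKernel_mul_cosTail_line r hz h1 hσ h2 h3).mul_const Complex.I).congr
      (Eventually.of_forall fun t => ?_)
    exact mul_right_comm _ _ _
  have hval : (∫ u in (0 : ℝ)..1, V u) + ∫ t, k t * cosTail (meijerPath (fun _ => σ) t) =
      (√Real.pi : ℂ) * (∫ t, besselKernel ρ (r + 1) (meijerPath (fun _ => σ) t) *
          ((4 * z : ℝ) : ℂ) ^ meijerPath (fun _ => σ) t) * Complex.I := by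
    rw [(hfub zero_le_one).2.2, ← integral_add (hfub zero_le_one).2.1 hkt, ← integral_const_mul,
      ← integral_mul_const]
    refine integral_congr_ae (Eventually.of_forall fun t => ?_)
    dsimp only
    rw [← mul_add, integral_zero_one_cpow_mul_cos_add_cosTail (by rw [hre]; exact h1) (by rw [hre]; exact hσ),
      ← besselKernel_mul_cosMellin ρ r hz]
    simp only [hkdef]
    ring
  have hcongr : ∀ a b : ℝ, 0 < a → 0 < b → Set.EqOn W (fun u => V u * (Complex.I)⁻¹) (Set.uIcc a b) := by
    intro a b ha hb u hu
    exact hWV u ((lt_min ha hb).trans_le hu.1)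
  constructor
  · intro a b ha hab
    exact ((hVi a b ha hab).mul_const _).congr
      (fun u hu => (hcongr a b ha (ha.trans_le hab) (Set.uIoc_subset_uIcc hu)).symm)
  · have h4 := hVt.mul_const (Complex.I)⁻¹
    rw [hval, mul_assoc _ Complex.I, mul_inv_cancel₀ Complex.I_ne_zero, mul_one] at h4
    refine h4.congr' ?_
    have hev : ∀ᶠ p : ℝ × ℝ in 𝓝[>] (0 : ℝ) ×ˢ atTop, p.1 ∈ Set.Ioi (0 : ℝ) ∧ 0 < p.2 :=
      (tendsto_fst.eventually self_mem_nhdsWithin).and (tendsto_snd.eventually (eventually_gt_atTop 0))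
    filter_upwards [hev] with p hp
    rw [intervalIntegral.integral_congr (hcongr _ _ hp.1 hp.2), intervalIntegral.integral_mul_const]

/-! ### Reduction of the Bessel factor to a cosine, and the induction. -/

/-- Legendre's duplication formula turns k! Γ(k+1/2) into (2k)! √π / 4^k, so the series matches that
of the cosine term by term. -/
theorem besselJ_neg_half {u : ℝ} (hu : 0 < u) :
    besselJ (-(1 / 2)) u = √2 / √Real.pi * u ^ (-(1 / 2) : ℝ) * Real.cos u := by
  have h := (Real.hasSum_cos u).mul_left (√2 / √Real.pi * u ^ (-(1 / 2) : ℝ))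
  rw [besselJ, ← h.tsum_eq]
  congr 1
  ext k
  have hd := Real.Gamma_mul_Gamma_add_half ((k : ℝ) + 1 / 2)
  have hg1 : Real.Gamma ((k : ℝ) + 1 / 2 + 1 / 2) = (k.factorial : ℝ) := by
    rw [add_assoc, add_halves, Real.Gamma_nat_eq_factorial]
  have hg2 : Real.Gamma (2 * ((k : ℝ) + 1 / 2)) = ((2 * k).factorial : ℝ) := by
    rw [← Real.Gamma_nat_eq_factorial]
    push_cast
    ring_nf
  have hp1 : (2 : ℝ) ^ (1 - 2 * ((k : ℝ) + 1 / 2)) = (2 ^ (2 * k))⁻¹ := by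
    rw [← Real.rpow_natCast, ← Real.rpow_neg zero_le_two]
    push_cast
    ring_nf
  rw [hg1, hg2, hp1] at hd
  have hp2 : (u / 2) ^ (2 * (k : ℝ) + -(1 / 2)) = u ^ (2 * k) / 2 ^ (2 * k) * (√2 * u ^ (-(1 / 2) : ℝ)) := by
    rw [Real.rpow_add (by positivity), Real.div_rpow hu.le zero_le_two _, Real.div_rpow hu.le zero_le_two _,
      Real.rpow_neg zero_le_two, ← Real.sqrt_eq_rpow]
    have e : ∀ v : ℝ, v ^ (2 * (k : ℝ)) = v ^ (2 * k) := by
      intro v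
      rw [← Real.rpow_natCast]
      push_cast
      rfl
    rw [e, e]
    field_simp
  have e1 : (k : ℝ) + -(1 / 2) + 1 = (k : ℝ) + 1 / 2 := by ring
  have hpi : 0 < √Real.pi := Real.sqrt_pos.2 Real.pi_pos
  rw [e1, mul_comm (k.factorial : ℝ), hd, hp2]
  field_simp

theorem HasMeijerG.unique {m n : ℕ} {a b : List ℂ} {z w w' : ℂ} (h : HasMeijerG m n a b z w)
    (h' : HasMeijerG m n a b z w') : w = w' := by
  obtain ⟨γ, hγ, hi⟩ := h.1
  rw [← h.2 γ hγ hi, ← h'.2 γ hγ hi]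

/-- At σ = -1/2 the growth exponent for index r is -1 - ρ - (r+1)/2, which is below -1 since ρ >
-1/2. The chosen ε leaves room for both r and r+1. -/
theorem exists_abscissa {ρ : ℝ} (hρ : -(1 / 2) < ρ) (r : ℕ) : ∃ σ : ℝ, -(1 / 2) < σ ∧ σ ≤ -(1 / 4) ∧
    besselExponent ρ r σ < -1 ∧ besselExponent ρ (r + 1) σ < -1 := by
  have hr : (0 : ℝ) ≤ r := Nat.cast_nonneg r
  set ε := min (1 / 4) ((ρ + 1 / 2) / (4 * (r + 2))) with hε
  have hε0 : 0 < ε := lt_min (by norm_num) (div_pos (by linarith) (by positivity))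
  have hε1 : ε * (4 * (r + 2)) ≤ ρ + 1 / 2 := by
    rw [← le_div_iff₀ (by positivity)]
    exact min_le_right _ _
  refine ⟨-(1 / 2) + ε, by linarith, by linarith [min_le_left (1 / 4) ((ρ + 1 / 2) / (4 * ((r : ℝ) + 2)))], ?_, ?_⟩
  · rw [besselExponent]
    nlinarith [mul_nonneg hε0.le hr]
  · rw [besselExponent]
    push_cast
    nlinarith [mul_nonneg hε0.le hr]

/-- A limit of real numbers is real, so the value computed through complex contour integrals needs
no separate proof of reality. -/
theorem hasImproperIntegral_of_ofReal {f : ℝ → ℝ} {Z : ℂ}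
    (hi : ∀ a b : ℝ, 0 < a → a ≤ b → IntervalIntegrable (fun u => (f u : ℂ)) volume a b)
    (ht : Tendsto (fun p : ℝ × ℝ => ∫ u in p.1..p.2, (f u : ℂ)) (𝓝[>] (0 : ℝ) ×ˢ atTop) (𝓝 Z)) :
    HasImproperIntegral f Z.re ∧ (Z.re : ℂ) = Z := by
  simp only [intervalIntegral.integral_ofReal] at ht
  refine ⟨⟨fun a b ha hab => ?_, ?_⟩, ?_⟩
  · have := hi a b ha hab
    exact ⟨this.1.re, this.2.re⟩
  · exact (Complex.continuous_re.tendsto Z).comp ht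
  · have h0 := (Complex.continuous_im.tendsto Z).comp ht
    simp only [Function.comp_def, Complex.ofReal_im] at h0
    have : Z.im = 0 := tendsto_nhds_unique h0 tendsto_const_nhds
    exact Complex.ext rfl this.symm

theorem besselK_constant_succ {ρ x : ℝ} (r : ℕ) :
    (√2 / √Real.pi * ((2 : ℝ) ^ (-ρ + ((r : ℝ) + 1) / 2) * x ^ (ρ - 1 / 2))) * √Real.pi =
      (2 : ℝ) ^ (-ρ + (((r + 1 : ℕ) : ℝ) + 1) / 2) * x ^ (ρ - 1 / 2) := by
  have hpi : 0 < √Real.pi := Real.sqrt_pos.2 Real.pi_pos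
  have e : -ρ + (((r + 1 : ℕ) : ℝ) + 1) / 2 = 1 / 2 + (-ρ + ((r : ℝ) + 1) / 2) := by push_cast; ring
  rw [e, Real.rpow_add two_pos (1 / 2), ← Real.sqrt_eq_rpow]
  field_simp

/-- The powers u^ρ, u^(-1/2) and u^(-(ρ-1/2)) multiply to 1; this cancellation is special to the
order -1/2. -/
theorem rpow_mul_besselJ_neg_half_mul {ρ x u : ℝ} (hx : 0 < x) (hu : 0 < u) (C : ℝ) :
    u ^ ρ * besselJ (-(1 / 2)) u * (C * (x / u) ^ (ρ - 1 / 2)) =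
      (√2 / √Real.pi * (C * x ^ (ρ - 1 / 2))) * Real.cos u := by
  have e : u ^ ρ = u ^ (1 / 2 : ℝ) * u ^ (ρ - 1 / 2) := by
    rw [← Real.rpow_add hu]
    ring_nf
  have hu1 : 0 < u ^ (1 / 2 : ℝ) := by positivity
  have hu2 : 0 < u ^ (ρ - 1 / 2) := by positivity
  rw [besselJ_neg_half hu, e, Real.div_rpow hx.le hu.le, Real.rpow_neg hu.le]
  field_simp

theorem theorem7p1 (r : ℕ) (ρ x : ℝ) (hρ : -(1 / 2) < ρ) (hx : 0 < x) :
    ∃ K : ℝ, HasBesselK ρ (-(1 / 2)) r x K ∧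
      ∃ G : ℂ,
        HasMeijerG 0 (r + 1)
          (List.replicate (r + 1) (1 / 2 : ℂ) ++ [(ρ : ℂ) + 1] ++ List.replicate r (0 : ℂ)) []
          (((4 : ℝ) ^ (r + 1) / x ^ 2 : ℝ) : ℂ) G ∧
        (K : ℂ) = (((2 : ℝ) ^ (-ρ + ((r : ℝ) + 1) / 2) * x ^ (ρ - 1 / 2) : ℝ) : ℂ) * G := by
  induction r generalizing x with
  | zero =>
    obtain ⟨σ, h1, h1', h2, -⟩ := exists_abscissa hρ 0
    refine ⟨besselJ (ρ + 1 / 2) x, rfl, _, hasMeijerG_line ρ 0 h1 h2 (by positivity), ?_⟩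
    rw [besselJ_eq_integral_besselKernel hx h1 (by linarith) hρ h2]
    simp
  | succ r ih =>
    obtain ⟨σ, h1, h1', h2, h3⟩ := exists_abscissa hρ r
    choose! F hF G hG hFG using ih
    set z : ℝ := 4 ^ (r + 1) / x ^ 2 with hz
    have hz0 : 0 < z := by positivity
    set A : ℝ := √2 / √Real.pi * ((2 : ℝ) ^ (-ρ + ((r : ℝ) + 1) / 2) * x ^ (ρ - 1 / 2)) with hA
    set c : ℂ := (A : ℂ) * (1 / (2 * (Real.pi : ℂ))) with hc
    set W : ℝ → ℂ := fun u => ((Real.cos u : ℝ) : ℂ) * ∫ t, besselKernel ρ r (meijerPath (fun _ => σ) t) *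
      ((z * u ^ 2 : ℝ) : ℂ) ^ meijerPath (fun _ => σ) t with hW
    obtain ⟨hWi, hWt⟩ := improper_integral_cos_besselKernel hρ r hz0 h1 h1' h2 h3 (W := W) (fun u _ => rfl)
    have hfW : ∀ u, 0 < u → ((u ^ ρ * besselJ (-(1 / 2)) u * F (x / u) : ℝ) : ℂ) = c * W u := by
      intro u hu
      have hxu : 0 < x / u := by positivity
      have hzu : (4 : ℝ) ^ (r + 1) / (x / u) ^ 2 = z * u ^ 2 := by
        rw [hz]
        field_simp
      -- The induction hypothesis may use a different G-value witness for each argument; uniqueness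
      -- identifies them all with integrals over the one line Re s = σ, as the interchange requires.
      have hGv := (hG (x / u) hxu).unique (hasMeijerG_line ρ r h1 h2 (by positivity))
      have hP := rpow_mul_besselJ_neg_half_mul (ρ := ρ) hx hu ((2 : ℝ) ^ (-ρ + ((r : ℝ) + 1) / 2))
      rw [Complex.ofReal_mul, hFG (x / u) hxu, hGv, hzu, ← mul_assoc, ← Complex.ofReal_mul, hP, hc, hW, ← hA]
      push_cast
      ring
    have hcongr : ∀ a b : ℝ, 0 < a → 0 < b → Set.EqOn
        (fun u => ((u ^ ρ * besselJ (-(1 / 2)) u * F (x / u) : ℝ) : ℂ)) (fun u => c * W u) (Set.uIcc a b) :=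
      fun a b ha hb u hu => hfW u ((lt_min ha hb).trans_le hu.1)
    have hmain := hasImproperIntegral_of_ofReal (f := fun u => u ^ ρ * besselJ (-(1 / 2)) u * F (x / u))
      (Z := c * ((√Real.pi : ℂ) * ∫ t, besselKernel ρ (r + 1) (meijerPath (fun _ => σ) t) *
          ((4 * z : ℝ) : ℂ) ^ meijerPath (fun _ => σ) t)) ?_ ?_
    · refine ⟨_, ⟨fun u => F (x / u), fun u hu => hF (x / u) (by positivity), hmain.1⟩, _,
        hasMeijerG_line ρ (r + 1) h1 h3 (by positivity), ?_⟩
      have h4 : (4 : ℝ) ^ (r + 1 + 1) / x ^ 2 = 4 * z := by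
        rw [hz, pow_succ]
        ring
      rw [hmain.2, h4, ← besselK_constant_succ, ← hA, hc]
      push_cast
      ring
    · intro a b ha hab
      exact ((hWi a b ha hab).const_mul c).congr
        (fun u hu => (hcongr a b ha (ha.trans_le hab) (Set.uIoc_subset_uIcc hu)).symm)
    · refine (hWt.const_mul c).congr' ?_
      have hev : ∀ᶠ p : ℝ × ℝ in 𝓝[>] (0 : ℝ) ×ˢ atTop, p.1 ∈ Set.Ioi (0 : ℝ) ∧ 0 < p.2 :=
        (tendsto_fst.eventually self_mem_nhdsWithin).and (tendsto_snd.eventually (eventually_gt_atTop 0))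
      filter_upwards [hev] with p hp
      rw [intervalIntegral.integral_congr (hcongr _ _ hp.1 hp.2), intervalIntegral.integral_const_mul]
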